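/- \textbf{Setting.} For $n\ge 1$ let $N=2^n$; identify basis states of $n$ qubits with $0,\dots,N-1$ (first qubit most significant). Let $X,Z$ be the Pauli matrices, $S_n|y\rangle=|y+1 \bmod N\rangle$, and let $C_n^-$ be the $N\times N$ antidiagonal matrix with antidiagonal $1,-1,\dots,-1,1$ (so $C_1^-=X$). Let $A_{n,1}$ be the tridiagonal matrix with $-2$ on the diagonal and $1$ next to it (Dirichlet), $A_{n,2}=-2I+S_n+S_n^\dagger$ (periodic; the entries of the matrix are the cyclic ones), and, for $a_0,a_1\in\mathbb R$ and $h=1/(2^n-1)$, let $A_{n,3}$ be obtained from $A_{n,1}$ by replacing the off-diagonal entries of the first and the last row by $2$, and the first and last diagonal entries by $-2+2a_0h$ and $-2-2a_1h$ (Neumann/Robin; for $n = 1$ these are the two diagonal entries). Put $X_*=I^{\otimes n-1}\otimes X$ and $Z_*=I^{\otimes n-1}\otimes Z$. Consider $$A_{n,1}=-2I+S_n+S_n^\dagger-\tfrac12X^{\otimes n}+\tfrac12(-C_n^-),\qquad A_{n,2}=-2I+S_n+S_n^\dagger,$$ $$A_{n,3}=\tfrac{-4+(a_0-a_1)h}{2}I+\tfrac12X_*-\tfrac12X^{\otimes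 n}+\tfrac{(a_0+a_1)h}{2}Z_*+S_n+S_n^\dagger-\tfrac12C_n^-+\tfrac{(a_0-a_1)h}{2}X^{\otimes n}C_n^-+\tfrac{(a_0+a_1)h}{2}X^{\otimes n}C_n^-Z_*+\tfrac12X^{\otimes n}C_n^-X_*,$$ and let $R_{\alpha,l}$ ($\alpha\in\{1,2,3\}$, $1\le l\le 5,3,10$ respectively) be the matrices that occur in these sums, in this order, without their coefficients. For unitaries $V,U_b$ on $n$ qubits, $R_l=R_{\alpha,l}$, and $Z_j$ the Pauli $Z$ on the $j$-th qubit, let $$\beta_{ll'}=\langle 0|V^\dagger R_{l'}^\dagger R_lV|0\rangle,\qquad \delta^{(j)}_{ll'}=\langle 0|V^\dagger R_{l'}^\dagger U_bZ_jU_b^\dagger R_lV|0\rangle .$$ Consider $n+2$ qubits: a test qubit, $n$ data qubits, and a work qubit. The Hadamard test for $\beta_{ll'}$ applies a Hadamard gate to the test qubit, $V$ to the data, $R_l$ and then $R_{l'}^\dagger$ to the data controlled by the test qubit, and a Hadamard gate to the test qubit, which is then measured; the test for $\delta^{(j)}_{ll'}$ has in addition $U_b^\dagger$, controlled $Z_j$,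 and $U_b$ between the two controlled operations. Both operators are the identity on the work qubit. \textbf{Lemma (VQLS cost).} The three identities above hold and all the $R_{\alpha,l}$ are unitary. There is an absolute constant $K$ such that for all $n\ge1$, $\alpha\in\{1,2,3\}$, all $l,l'$, and all $j\in\{1,\dots,n\}$, the operators of the Hadamard tests for $\beta_{ll'}$ and for $\delta^{(j)}_{ll'}$ are each implemented exactly (so that the work qubit is returned in its initial state, whatever that is) by a circuit on the $n+2$ qubits that consists of at most $6$ Hadamard gates in total (those of the test on the test qubit included), at most $Kn$ $X$ gates, at most $Kn$ CNOT gates, at most $Kn$ Toffoli gates, at most two uses of $V$, and at most two uses of $U_b$ or $U_b^\dagger$. This circuit, as a list of gates, does not depend on $V$, $U_b$, $a_0$, $a_1$. When it is run on $|0\cdots0\rangle$, the outcome probabilities of the test qubit satisfy $P(0)-P(1)=\operatorname{Re}\beta_{ll'}$ and $\operatorname{Re}\delta^{(j)}_{ll'}$, respectively; $\beta_{ll'}$ is real if $V$ has real entries, and $\delta^{(j)}_{ll'}$ is real if $V$ and $U_b$ have real entries. -/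

import Mathlib

namespace VQLS

open scoped Matrix BigOperators

noncomputable section

/-- Computational basis of a register of `k` qubits, numbered `0, …, k - 1`. -/
abbrev Basis (k : ℕ) := Fin k → Fin 2

/-- Operators on a register of `k` qubits, as matrices in the computational basis. -/
abbrev Op (k : ℕ) := Matrix (Basis k) (Basis k) ℂ

/-- The number in `{0, …, 2 ^ k - 1}` of a basis state; qubit `0` is the most significant bit,
so that this is the order of the Kronecker product. -/
def val {k : ℕ} (x : Basis k) : ℕ := ∑ i, (x i : ℕ) * 2 ^ (k - 1 - (i : ℕ))

def pauliX : Matrix (Fin 2) (Fin 2) ℂ := !![0, 1; 1, 0]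

def pauliZ : Matrix (Fin 2) (Fin 2) ℂ := !![1, 0; 0, -1]

def hadamard : Matrix (Fin 2) (Fin 2) ℂ := ((1 / Real.sqrt 2 : ℝ) : ℂ) • !![1, 1; 1, -1]

/-- The tensor product `M 0 ⊗ M 1 ⊗ ⋯ ⊗ M (k - 1)`. -/
def tensor {k : ℕ} (M : Fin k → Matrix (Fin 2) (Fin 2) ℂ) : Op k :=
  Matrix.of fun x y => ∏ i, M i (x i) (y i)

/-- `I ⊗ ⋯ ⊗ M ⊗ ⋯ ⊗ I` with `M` at qubit `q`. -/
def onQubit {k : ℕ} (q : Fin k) (M : Matrix (Fin 2) (Fin 2) ℂ) : Op k :=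
  tensor fun i => if i = q then M else 1

/-- `I ⊗ ⋯ ⊗ I ⊗ M`. -/
def onLast (k : ℕ) (M : Matrix (Fin 2) (Fin 2) ℂ) : Op k :=
  tensor fun i => if (i : ℕ) + 1 = k then M else 1

/-- The basis state with bit `t` negated. -/
def flip {k : ℕ} (t : Fin k) (x : Basis k) : Basis k := Function.update x t (1 - x t)

/-- The multicontrolled `NOT` operation with set of controls `C` and target `t`. -/
def ctrlNot {k : ℕ} (C : Finset (Fin k)) (t : Fin k) : Op k :=
  Matrix.of fun x y => if x = (if ∀ c ∈ C, y c = 1 then flip t y else y) then 1 else 0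

/-! ### The matrices and their decompositions -/

/-- `X ⊗ ⋯ ⊗ X`. -/
def xAll (n : ℕ) : Op n := tensor fun _ => pauliX

/-- The increment gate `|y⟩ ↦ |y + 1 mod 2 ^ n⟩`. -/
def incr (n : ℕ) : Op n :=
  Matrix.of fun x y => if val x = (val y + 1) % 2 ^ n then 1 else 0

/-- The antidiagonal matrix with antidiagonal `1, -1, …, -1, 1`. -/
def cMinus (n : ℕ) : Op n :=
  Matrix.of fun x y =>
    if val x + val y + 1 = 2 ^ n then (if val x = 0 ∨ val y = 0 then 1 else -1) else 0

/-- The three types of one-dimensional boundary conditions. -/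
inductive Boundary where
  | dirichlet
  | periodic
  | robin

/-- The mesh width of the Neumann/Robin scheme. -/
def meshRobin (n : ℕ) : ℝ := 1 / ((2 : ℝ) ^ n - 1)

/-- The normalized (multiplied by the squared mesh width) discrete Laplacians. The parameters
`a₀`, `a₁` of the Robin conditions `u'(0) + a₀ u(0) = b₀`, `u'(1) + a₁ u(1) = b₁` are used only in
the Neumann/Robin case. -/
def laplacian (n : ℕ) (a₀ a₁ : ℝ) : Boundary → Op n
  | .dirichlet => Matrix.of fun x y =>
      if val x = val y then -2
      else if val x + 1 = val y ∨ val y + 1 = val x then 1 else 0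
  | .periodic => Matrix.of fun x y =>
      (if val x = val y then -2 else 0) + (if val x = (val y + 1) % 2 ^ n then 1 else 0)
        + (if val y = (val x + 1) % 2 ^ n then 1 else 0)
  | .robin => Matrix.of fun x y =>
      if val x = val y then
        -2 + (if val x = 0 then ((2 * a₀ * meshRobin n : ℝ) : ℂ) else 0)
          - (if val x + 1 = 2 ^ n then ((2 * a₁ * meshRobin n : ℝ) : ℂ) else 0)
      else if val x + 1 = val y ∨ val y + 1 = val x then
        (if val x = 0 ∨ val x + 1 = 2 ^ n then 2 else 1)
      else 0

/-- The number of terms of the decomposition. -/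
def numTerms : Boundary → ℕ
  | .dirichlet => 5
  | .periodic => 3
  | .robin => 10

/-- The unitaries of the decomposition. -/
def lcuTerm (n : ℕ) : (α : Boundary) → Fin (numTerms α) → Op n
  | .dirichlet => ![1, incr n, (incr n)ᴴ, xAll n, -cMinus n]
  | .periodic => ![1, incr n, (incr n)ᴴ]
  | .robin => ![1, onLast n pauliX, xAll n, onLast n pauliZ, incr n, (incr n)ᴴ, cMinus n,
      xAll n * cMinus n, xAll n * cMinus n * onLast n pauliZ, xAll n * cMinus n * onLast n pauliX]

/-- The coefficients of the decomposition. -/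
def lcuCoeff (n : ℕ) (a₀ a₁ : ℝ) : (α : Boundary) → Fin (numTerms α) → ℝ
  | .dirichlet => ![-2, 1, 1, -1 / 2, 1 / 2]
  | .periodic => ![-2, 1, 1]
  | .robin => ![(-4 + (a₀ - a₁) * meshRobin n) / 2, 1 / 2, -1 / 2, (a₀ + a₁) * meshRobin n / 2,
      1, 1, -1 / 2, (a₀ - a₁) * meshRobin n / 2, (a₀ + a₁) * meshRobin n / 2, 1 / 2]

/-! ### The terms of the local cost function -/

/-- `⟨0| V† R'† R V |0⟩`. -/
def beta {n : ℕ} (R R' V : Op n) : ℂ := (Vᴴ * R'ᴴ * R * V) 0 0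

/-- `⟨0| V† R'† U Z_j U† R V |0⟩`. -/
def delta {n : ℕ} (R R' : Op n) (j : Fin n) (V U : Op n) : ℂ :=
  (Vᴴ * R'ᴴ * U * onQubit j pauliZ * Uᴴ * R * V) 0 0

/-! ### Circuits on `n + 2` qubits

Qubit `0` is the qubit that the Hadamard test measures, qubits `1, …, n` are the data register and
qubit `n + 1` is the work qubit. -/

/-- Qubit `i` of the data register, as a qubit of the whole register. -/
def dataQubit {n : ℕ} (i : Fin n) : Fin (n + 2) := i.succ.castSucc

/-- The part of a basis state on the data register. -/
def dataPart {n : ℕ} (x : Basis (n + 2)) : Basis n := fun i => x (dataQubit i)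

/-- `I ⊗ M ⊗ I`, with `M` on the data register. -/
def onData {n : ℕ} (M : Op n) : Op (n + 2) :=
  Matrix.of fun x y =>
    if x 0 = y 0 ∧ x (Fin.last (n + 1)) = y (Fin.last (n + 1))
    then M (dataPart x) (dataPart y) else 0

/-- `M` on the data register controlled by qubit `0`, with identity on the work qubit:
`|0⟩⟨0| ⊗ I ⊗ I + |1⟩⟨1| ⊗ M ⊗ I`. -/
def ctrlData {n : ℕ} (M : Op n) : Op (n + 2) :=
  Matrix.of fun x y =>
    if x 0 = y 0 ∧ x (Fin.last (n + 1)) = y (Fin.last (n + 1))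
    then (if y 0 = 1 then M else 1) (dataPart x) (dataPart y) else 0

/-- The operator of the Hadamard test for `beta`: Hadamard on qubit `0`, then `V`, controlled `R`,
controlled `R'†`, and Hadamard on qubit `0`. It is the identity on the work qubit. -/
def betaTest {n : ℕ} (R R' V : Op n) : Op (n + 2) :=
  onQubit 0 hadamard * ctrlData R'ᴴ * ctrlData R * onData V * onQubit 0 hadamard

/-- The operator of the Hadamard test for `delta`: Hadamard on qubit `0`, then `V`, controlled `R`,
`U†`, controlled `Z_j`, `U`, controlled `R'†`, and Hadamard on qubit `0`. -/
def deltaTest {n : ℕ} (R R' : Op n) (j : Fin n) (V U : Op n) : Op (n + 2) :=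
  onQubit 0 hadamard * ctrlData R'ᴴ * onData U * ctrlData (onQubit j pauliZ) * onData Uᴴ
    * ctrlData R * onData V * onQubit 0 hadamard

/-- The gates: Hadamard, `X`, `CNOT`, Toffoli, the ansatz `V`, the state preparation `U` and its
inverse; the last three act on the data register. -/
inductive Gate (n : ℕ) where
  | had (q : Fin (n + 2))
  | x (q : Fin (n + 2))
  | cnot (c t : Fin (n + 2)) (h : c ≠ t)
  | toffoli (c₁ c₂ t : Fin (n + 2)) (h₁₂ : c₁ ≠ c₂) (h₁ : c₁ ≠ t) (h₂ : c₂ ≠ t)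
  | ansatz
  | prep
  | prepInv

/-- The operator of a gate, for given unitaries `V` and `U`. -/
def Gate.op {n : ℕ} (V U : Op n) : Gate n → Op (n + 2)
  | .had q => onQubit q hadamard
  | .x q => onQubit q pauliX
  | .cnot c t _ => ctrlNot {c} t
  | .toffoli c₁ c₂ t _ _ _ => ctrlNot {c₁, c₂} t
  | .ansatz => onData V
  | .prep => onData U
  | .prepInv => onData Uᴴ

/-- The number of gates of each kind, an element of `ℕ⁶`. -/
structure Cost where
  had : ℕ
  x : ℕ
  cnot : ℕ
  toffoli : ℕ
  ansatz : ℕ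
  prep : ℕ

/-- The cost of a circuit, which is the list of its gates in the order of their application;
the inverse of the state preparation costs as much as the state preparation. -/
def cost {n : ℕ} : List (Gate n) → Cost
  | [] => ⟨0, 0, 0, 0, 0, 0⟩
  | g :: gs =>
    let s := cost gs
    match g with
    | .had _ => { s with had := s.had + 1 }
    | .x _ => { s with x := s.x + 1 }
    | .cnot _ _ _ => { s with cnot := s.cnot + 1 }
    | .toffoli _ _ _ _ _ _ => { s with toffoli := s.toffoli + 1 }
    | .ansatz => { s with ansatz := s.ansatz + 1 }
    | .prep => { s with prep := s.prep + 1 }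
    | .prepInv => { s with prep := s.prep + 1 }

/-- At most 6 Hadamard gates, at most `B` gates `X`, at most `B` gates `CNOT`, at most `B` Toffoli
gates, and at most two uses of each of `V` and `U`. -/
def Cost.Within (s : Cost) (B : ℕ) : Prop :=
  s.had ≤ 6 ∧ s.x ≤ B ∧ s.cnot ≤ B ∧ s.toffoli ≤ B ∧ s.ansatz ≤ 2 ∧ s.prep ≤ 2

/-- The operator of a circuit, whose gates are applied from left to right. -/
def circuitOp {n : ℕ} (V U : Op n) : List (Gate n) → Op (n + 2)
  | [] => 1
  | g :: gs => circuitOp V U gs * g.op V U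

/-- The probability of the outcome `b` when qubit `0` is measured after `W` has been applied to
`|0…0⟩`. -/
def outcomeProb {n : ℕ} (W : Op (n + 2)) (b : Fin 2) : ℝ :=
  ∑ x : Basis (n + 2), if x 0 = b then ‖(W *ᵥ Pi.single 0 1) x‖ ^ 2 else 0

/-- The matrix has real entries. -/
def IsReal {n : ℕ} (M : Op n) : Prop := ∀ x y, (M x y).im = 0

/-- The difference of the two outcome probabilities is the real part of `z`. -/
def Estimates {n : ℕ} (W : Op (n + 2)) (z : ℂ) : Prop :=
  outcomeProb W 0 - outcomeProb W 1 = z.re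

end

end VQLS

/-! Every term of the three decompositions is a signed permutation `|y⟩ ↦ (-1)^(f y) |π y⟩`. Here
`π` is the identity, the increment or its inverse, the negation of all bits, or the negation of the
last bit. The sign `f` is built from the indicator of the two corner states `0` and `2^n - 1`, a
constant, and the last bit. Real entries and unitarity are immediate from this form.

The sign needs no controlled phase gate. On the test qubit `Z^c H = H X^c`, so a controlled signed
permutation preceded by a Hadamard equals three steps: XOR `f` into the test qubit, apply the
Hadamard, apply the controlled `π` (`ctrlData_mul_hadamard`). The adjoint identity treats `R'†`
together with the last Hadamard. Since `V` commutes with the first Hadamard, the test for `beta`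
needs only two Hadamard gates. Controlled `Z_j` is a CNOT onto the test qubit between two more,
which gives four for `delta`.

It remains to implement `π` under control, and to XOR `f`, with linearly many classical gates when
the only extra qubit is the work qubit in an unknown state. Idle qubits are therefore borrowed and
restored. Multicontrolled NOTs are ladders of Toffoli gates, in which each half of the controls
serves as borrowed qubits for the other half (`run_mcx`, `run_mcxOne`). The increment splits the
register into halves. A bit is added to one half by adding the unknown number in the other half and
then subtracting it with a changed carry bit (`run_addBit`); the carry between the halves is a
multicontrolled NOT (`exists_increment_even`).

The probability formula is the polarization identity applied to the two branches of the test
(`estimates_hadamardTest`). The decompositions are compared entry by entry, as functions of the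
numbers of the row and the column. -/

namespace VQLS

open scoped Matrix BigOperators

/-! ### Classical reversible circuits -/

/-- The action of a classical gate on basis states. -/
def Gate.act {n : ℕ} : Gate n → Basis (n + 2) → Basis (n + 2)
  | .x q, s => Function.update s q (s q + 1)
  | .cnot c t _, s => Function.update s t (s t + s c)
  | .toffoli c₁ c₂ t _ _ _, s => Function.update s t (s t + s c₁ * s c₂)
  | _, s => s

/-- The gate permutes the basis states. -/
def Gate.IsClassical {n : ℕ} : Gate n → Prop
  | .x _ => True
  | .cnot _ _ _ => True
  | .toffoli _ _ _ _ _ _ => True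
  | _ => False

/-- The gate does not involve the qubit `q`. -/
def Gate.Avoids {n : ℕ} (q : Fin (n + 2)) : Gate n → Prop
  | .x q' => q ≠ q'
  | .cnot c t _ => q ≠ c ∧ q ≠ t
  | .toffoli c₁ c₂ t _ _ _ => q ≠ c₁ ∧ q ≠ c₂ ∧ q ≠ t
  | _ => True

/-- The action of a classical circuit on basis states. -/
def run {n : ℕ} : List (Gate n) → Basis (n + 2) → Basis (n + 2)
  | [], s => s
  | g :: gs, s => run gs (g.act s)

variable {n : ℕ}

@[simp] theorem run_nil (s : Basis (n + 2)) : run [] s = s := rfl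

theorem run_cons (g : Gate n) (gs : List (Gate n)) (s : Basis (n + 2)) :
    run (g :: gs) s = run gs (g.act s) := rfl

theorem run_append (l m : List (Gate n)) (s : Basis (n + 2)) :
    run (l ++ m) s = run m (run l s) := by
  induction l generalizing s with
  | nil => rfl
  | cons g l ih => simp [run_cons, ih]

theorem Gate.act_act (g : Gate n) (s : Basis (n + 2)) : g.act (g.act s) = s := by
  have key : ∀ a b : Fin 2, a + b + b = a := by decide
  cases g with
  | x q => simp [Gate.act, key]
  | cnot c t h => simp [Gate.act, key, Function.update_of_ne h]
  | toffoli c₁ c₂ t h₁₂ h₁ h₂ =>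
    simp [Gate.act, key, Function.update_of_ne h₁, Function.update_of_ne h₂]
  | _ => rfl

/-- Each classical gate is its own inverse, because its controls differ from its target and addition
in `Fin 2` is XOR. -/
theorem run_reverse_run (l : List (Gate n)) (s : Basis (n + 2)) :
    run l.reverse (run l s) = s := by
  induction l generalizing s with
  | nil => rfl
  | cons g l ih => simp [run_cons, run_append, ih, Gate.act_act]

theorem run_run_reverse (l : List (Gate n)) (s : Basis (n + 2)) :
    run l (run l.reverse s) = s := by
  simpa using run_reverse_run l.reverse s

theorem Gate.act_update {q : Fin (n + 2)} {g : Gate n} (h : g.Avoids q) (s : Basis (n + 2))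
    (b : Fin 2) : g.act (Function.update s q b) = Function.update (g.act s) q b := by
  cases g with
  | x q' =>
    have h : q ≠ q' := h
    simp [Gate.act, Function.update_of_ne h.symm, Function.update_comm h]
  | cnot c t _ =>
    obtain ⟨h₁, h₂⟩ := h
    simp [Gate.act, Function.update_of_ne h₁.symm, Function.update_of_ne h₂.symm,
      Function.update_comm h₂]
  | toffoli c₁ c₂ t _ _ _ =>
    obtain ⟨h₁, h₂, h₃⟩ := h
    simp [Gate.act, Function.update_of_ne h₁.symm, Function.update_of_ne h₂.symm,
      Function.update_of_ne h₃.symm, Function.update_comm h₃]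
  | _ => rfl

/-- Serves to move the Toffoli gates that act on the target of `chain` past the recursive call,
which does not involve that target. -/
theorem run_update {q : Fin (n + 2)} {l : List (Gate n)} (h : ∀ g ∈ l, g.Avoids q)
    (s : Basis (n + 2)) (b : Fin 2) :
    run l (Function.update s q b) = Function.update (run l s) q b := by
  induction l generalizing s with
  | nil => rfl
  | cons g l ih =>
    simp only [List.mem_cons, forall_eq_or_imp] at h
    simp [run_cons, Gate.act_update h.1, ih h.2]

/-- A `CNOT` gate, or nothing if the qubits coincide. -/
def cn (c t : Fin (n + 2)) : List (Gate n) :=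
  if h : c ≠ t then [.cnot c t h] else []

/-- A Toffoli gate, or nothing if two of the qubits coincide. -/
def tof (c₁ c₂ t : Fin (n + 2)) : List (Gate n) :=
  if h : c₁ ≠ c₂ ∧ c₁ ≠ t ∧ c₂ ≠ t then [.toffoli c₁ c₂ t h.1 h.2.1 h.2.2] else []

theorem run_cn {c t : Fin (n + 2)} (h : c ≠ t) (s : Basis (n + 2)) :
    run (cn c t) s = Function.update s t (s t + s c) := by
  simp [cn, h, run, Gate.act]

theorem run_tof {c₁ c₂ t : Fin (n + 2)} (h₁₂ : c₁ ≠ c₂) (h₁ : c₁ ≠ t) (h₂ : c₂ ≠ t)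
    (s : Basis (n + 2)) :
    run (tof c₁ c₂ t) s = Function.update s t (s t + s c₁ * s c₂) := by
  simp [tof, h₁₂, h₁, h₂, run, Gate.act]

theorem run_x (q : Fin (n + 2)) (s : Basis (n + 2)) :
    run [.x q] s = Function.update s q (s q + 1) := rfl

@[simp] theorem reverse_cn (c t : Fin (n + 2)) : (cn c t).reverse = cn c t := by
  unfold cn; split_ifs <;> rfl

@[simp] theorem reverse_tof (c₁ c₂ t : Fin (n + 2)) : (tof c₁ c₂ t).reverse = tof c₁ c₂ t := by
  unfold tof; split_ifs <;> rfl

theorem avoids_cn {q c t : Fin (n + 2)} (h₁ : q ≠ c) (h₂ : q ≠ t) :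
    ∀ g ∈ cn c t, g.Avoids q := by
  unfold cn; split_ifs <;> simp_all [Gate.Avoids]

theorem avoids_tof {q c₁ c₂ t : Fin (n + 2)} (h₁ : q ≠ c₁) (h₂ : q ≠ c₂) (h₃ : q ≠ t) :
    ∀ g ∈ tof c₁ c₂ t, g.Avoids q := by
  unfold tof; split_ifs <;> simp_all [Gate.Avoids]

/-! ### Counting classical gates, and conjunctions of bits -/

/-- The circuit consists of at most `B` classical gates. -/
def ClassicalWithin (l : List (Gate n)) (B : ℕ) : Prop :=
  (∀ g ∈ l, g.IsClassical) ∧ l.length ≤ B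

theorem ClassicalWithin.mono {l : List (Gate n)} {B B' : ℕ} (h : ClassicalWithin l B)
    (hB : B ≤ B') : ClassicalWithin l B' := ⟨h.1, h.2.trans hB⟩

theorem ClassicalWithin.append {l m : List (Gate n)} {B B' : ℕ} (h : ClassicalWithin l B)
    (h' : ClassicalWithin m B') : ClassicalWithin (l ++ m) (B + B') := by
  refine ⟨fun g hg => ?_, ?_⟩
  · rcases List.mem_append.1 hg with hg | hg
    exacts [h.1 g hg, h'.1 g hg]
  · simpa using add_le_add h.2 h'.2

theorem ClassicalWithin.reverse {l : List (Gate n)} {B : ℕ} (h : ClassicalWithin l B) :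
    ClassicalWithin l.reverse B := ⟨by simpa using h.1, by simpa using h.2⟩

theorem classicalWithin_nil (B : ℕ) : ClassicalWithin ([] : List (Gate n)) B := by
  simp [ClassicalWithin]

theorem classicalWithin_x (q : Fin (n + 2)) : ClassicalWithin [Gate.x q] 1 := by
  simp [ClassicalWithin, Gate.IsClassical]

theorem classicalWithin_cn (c t : Fin (n + 2)) : ClassicalWithin (cn c t) 1 := by
  unfold cn; split_ifs <;> simp [ClassicalWithin, Gate.IsClassical]

theorem classicalWithin_tof (c₁ c₂ t : Fin (n + 2)) : ClassicalWithin (tof c₁ c₂ t) 1 := by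
  unfold tof; split_ifs <;> simp [ClassicalWithin, Gate.IsClassical]

/-- The conjunction of the bits at the qubits of a list. -/
def conj (s : Basis (n + 2)) : List (Fin (n + 2)) → Fin 2
  | [] => 1
  | q :: l => s q * conj s l

theorem conj_congr {s s' : Basis (n + 2)} {l : List (Fin (n + 2))} (h : ∀ q ∈ l, s q = s' q) :
    conj s l = conj s' l := by
  induction l with
  | nil => rfl
  | cons q l ih =>
    simp only [List.mem_cons, forall_eq_or_imp] at h
    simp [conj, h.1, ih h.2]

theorem conj_append (s : Basis (n + 2)) (l m : List (Fin (n + 2))) :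
    conj s (l ++ m) = conj s l * conj s m := by
  induction l with
  | nil => simp [conj]
  | cons q l ih =>
    have : ∀ a b c : Fin 2, a * (b * c) = a * b * c := by decide
    simp [conj, ih, this]

theorem conj_update_of_notMem {s : Basis (n + 2)} {l : List (Fin (n + 2))} {t : Fin (n + 2)}
    (h : t ∉ l) (b : Fin 2) : conj (Function.update s t b) l = conj s l :=
  conj_congr fun _ hq => Function.update_of_ne (by rintro rfl; exact h hq) _ _

/-! ### Multicontrolled gates with borrowed qubits -/

/-- Flips `t` if `c₀` and the first components of the pairs are all `1`. The second components
are used as borrowed qubits, and are left modified. -/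
def chain (t c₀ : Fin (n + 2)) : List (Fin (n + 2) × Fin (n + 2)) → List (Gate n)
  | [] => cn c₀ t
  | p :: r => tof p.1 p.2 t ++ (chain p.2 c₀ r ++ tof p.1 p.2 t)

/-- The target and the borrowed qubits are distinct, and different from the controls. -/
def ChainOK (t c₀ : Fin (n + 2)) (r : List (Fin (n + 2) × Fin (n + 2))) : Prop :=
  (t :: r.map Prod.snd).Nodup ∧ ∀ c ∈ c₀ :: r.map Prod.fst, c ∉ t :: r.map Prod.snd

theorem ChainOK.tail {t c₀ : Fin (n + 2)} {p : Fin (n + 2) × Fin (n + 2)}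
    {r : List (Fin (n + 2) × Fin (n + 2))} (h : ChainOK t c₀ (p :: r)) : ChainOK p.2 c₀ r := by
  obtain ⟨h₁, h₂⟩ := h
  simp only [List.map_cons, List.nodup_cons] at h₁
  refine ⟨by simpa using h₁.2, fun c hc h => h₂ c ?_ ?_⟩
  · simp only [List.map_cons, List.mem_cons] at hc ⊢; tauto
  · simp only [List.map_cons, List.mem_cons] at h ⊢; tauto

/-- The circuit is a palindrome of involutions, so a second run undoes the first; `mcx` restores its
borrowed qubits in this way. -/
theorem reverse_chain (t c₀ : Fin (n + 2)) (r : List (Fin (n + 2) × Fin (n + 2))) :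
    (chain t c₀ r).reverse = chain t c₀ r := by
  induction r generalizing t with
  | nil => simp [chain]
  | cons p r ih => simp [chain, ih]

theorem run_chain_run_chain (t c₀ : Fin (n + 2)) (r : List (Fin (n + 2) × Fin (n + 2)))
    (s : Basis (n + 2)) : run (chain t c₀ r) (run (chain t c₀ r) s) = s := by
  have := run_reverse_run (chain t c₀ r) s
  rwa [reverse_chain] at this

theorem avoids_chain {q t c₀ : Fin (n + 2)} {r : List (Fin (n + 2) × Fin (n + 2))}
    (h : q ∉ t :: c₀ :: (r.map Prod.fst ++ r.map Prod.snd)) :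
    ∀ g ∈ chain t c₀ r, g.Avoids q := by
  induction r generalizing t with
  | nil =>
    simp only [List.map_nil, List.append_nil, List.mem_cons, List.not_mem_nil, or_false,
      not_or] at h
    exact avoids_cn h.2 h.1
  | cons p r ih =>
    simp only [List.map_cons, List.cons_append, List.mem_cons, List.mem_append, not_or] at h
    obtain ⟨h₁, h₂, h₃, h₄, h₅, h₆⟩ := h
    have h₀ : ∀ g ∈ tof p.1 p.2 t, g.Avoids q := avoids_tof h₃ h₅ h₁
    have h₇ : ∀ g ∈ chain p.2 c₀ r, g.Avoids q := ih (by simp_all)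
    intro g hg
    simp only [chain, List.mem_append] at hg
    rcases hg with hg | hg | hg
    exacts [h₀ g hg, h₇ g hg, h₀ g hg]

/-- The value of `t` after `chain`, and the qubits that are not modified. -/
theorem run_chain_apply {t c₀ : Fin (n + 2)} {r : List (Fin (n + 2) × Fin (n + 2))}
    (h : ChainOK t c₀ r) (s : Basis (n + 2)) :
    run (chain t c₀ r) s t = s t + s c₀ * conj s (r.map Prod.fst) ∧
      ∀ q ∉ t :: r.map Prod.snd, run (chain t c₀ r) s q = s q := by
  induction r generalizing t s with
  | nil =>
    have hc : c₀ ≠ t := by simpa using h.2 c₀ (by simp)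
    refine ⟨by simp [chain, run_cn hc, conj], fun q hq => ?_⟩
    have hq : q ≠ t := by simpa using hq
    simp [chain, run_cn hc, hq]
  | cons p r ih =>
    obtain ⟨c, d⟩ := p
    have ht := h.tail
    obtain ⟨h₁, h₂⟩ := h
    simp only [List.map_cons, List.nodup_cons, List.mem_cons, not_or, forall_eq_or_imp]
      at h₁ h₂
    obtain ⟨⟨htd, htr⟩, hdr, -⟩ := h₁
    obtain ⟨⟨c1, c2, c3⟩, ⟨c4, c5, c6⟩, h₂⟩ := h₂
    have htav : ∀ g ∈ chain d c₀ r, g.Avoids t := avoids_chain (by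
      simp only [List.mem_cons, List.mem_append, not_or]
      exact ⟨htd, Ne.symm c1, fun hm => (h₂ t hm).1 rfl, htr⟩)
    obtain ⟨i₁, i₂⟩ := ih ht s
    have ic : run (chain d c₀ r) s c = s c := i₂ c (by simp [c5, c6])
    -- The two Toffoli gates see the borrowed qubit before and after its change. Its unknown value
    -- cancels and only the change reaches the target.
    have key : ∀ a b c d : Fin 2, a + b * c + b * (c + d) = a + b * d := by decide
    have comm : ∀ a b c : Fin 2, a * (b * c) = b * (a * c) := by decide
    simp only [chain, run_append, run_tof c5 c4 (Ne.symm htd), run_update htav]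
    refine ⟨?_, fun q hq => ?_⟩
    · simp only [Function.update_self, Function.update_of_ne c4, Function.update_of_ne (Ne.symm htd),
        ic, List.map_cons, conj]
      dsimp only at i₁
      rw [i₁, key, comm]
    · simp only [List.map_cons, List.mem_cons, not_or] at hq
      simp only [Function.update_of_ne hq.1]
      exact i₂ q (by simp [hq])

/-- Apart from the target, the damage done to the borrowed qubits is exactly that of the shorter
chain. This is why running the shorter chain once more repairs it in `run_mcx`. -/
theorem run_chain_cons {t c₀ : Fin (n + 2)} {p : Fin (n + 2) × Fin (n + 2)}
    {r : List (Fin (n + 2) × Fin (n + 2))} (h : ChainOK t c₀ (p :: r)) (s : Basis (n + 2)) :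
    run (chain t c₀ (p :: r)) s = Function.update (run (chain p.2 c₀ r) s) t
      (s t + s c₀ * conj s ((p :: r).map Prod.fst)) := by
  have h1 := (run_chain_apply h s).1
  obtain ⟨c, d⟩ := p
  obtain ⟨h₁, h₂⟩ := h
  simp only [List.map_cons, List.nodup_cons, List.mem_cons, not_or, forall_eq_or_imp]
    at h₁ h₂
  obtain ⟨⟨htd, htr⟩, hdr, -⟩ := h₁
  obtain ⟨⟨c1, c2, c3⟩, ⟨c4, c5, c6⟩, h₂⟩ := h₂
  have htav : ∀ g ∈ chain d c₀ r, g.Avoids t := avoids_chain (by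
    simp only [List.mem_cons, List.mem_append, not_or]
    exact ⟨htd, Ne.symm c1, fun hm => (h₂ t hm).1 rfl, htr⟩)
  rw [← h1]
  simp only [chain, run_append, run_tof c5 c4 (Ne.symm htd), run_update htav]
  simp

/-- Flips `t` if `c₀` and the first components of the pairs are all `1`; the second components
are borrowed qubits. -/
def mcx (t c₀ : Fin (n + 2)) : List (Fin (n + 2) × Fin (n + 2)) → List (Gate n)
  | [] => cn c₀ t
  | p :: r => chain t c₀ (p :: r) ++ chain p.2 c₀ r

theorem run_mcx {t c₀ : Fin (n + 2)} {r : List (Fin (n + 2) × Fin (n + 2))}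
    (h : ChainOK t c₀ r) (s : Basis (n + 2)) :
    run (mcx t c₀ r) s = Function.update s t (s t + s c₀ * conj s (r.map Prod.fst)) := by
  cases r with
  | nil =>
    have hc : c₀ ≠ t := by simpa using h.2 c₀ (by simp)
    simp [mcx, run_cn hc, conj]
  | cons p r =>
    have h' := h
    obtain ⟨h₁, h₂⟩ := h
    simp only [List.map_cons, List.nodup_cons, List.mem_cons, not_or, forall_eq_or_imp]
      at h₁ h₂
    have htav : ∀ g ∈ chain p.2 c₀ r, g.Avoids t := avoids_chain (by
      simp only [List.mem_cons, List.mem_append, not_or]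
      exact ⟨h₁.1.1, Ne.symm h₂.1.1, fun hm => (h₂.2.2 t hm).1 rfl, h₁.1.2⟩)
    rw [mcx, run_append, run_chain_cons h', run_update htav, run_chain_run_chain]

/-- Flips `t` if `c₀` and the components of the pairs are all `1`, with one borrowed qubit `w`. -/
def mcxOne (t c₀ w : Fin (n + 2)) (r : List (Fin (n + 2) × Fin (n + 2))) : List (Gate n) :=
  mcx w c₀ r ++ mcx t w (r.map Prod.swap) ++ (mcx w c₀ r ++ mcx t w (r.map Prod.swap))

/-- A commutator argument. With `a` the conjunction that is added to `w` and `q` that of the other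
half, the target receives `(w + a) q + w q = a q`, independently of `w`, and `w` receives `a` twice.
Each half of the controls is borrowed while the other half is evaluated. -/
theorem run_mcxOne {t c₀ w : Fin (n + 2)} {r : List (Fin (n + 2) × Fin (n + 2))}
    (h : ChainOK w c₀ r) (h' : ChainOK t w (r.map Prod.swap)) (hc : c₀ ≠ t)
    (s : Basis (n + 2)) :
    run (mcxOne t c₀ w r) s = Function.update s t
      (s t + s c₀ * (conj s (r.map Prod.fst) * conj s (r.map Prod.snd))) := by
  have e₁ : (r.map Prod.swap).map Prod.fst = r.map Prod.snd := by simp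
  have e₂ : (r.map Prod.swap).map Prod.snd = r.map Prod.fst := by simp
  have hcw : c₀ ≠ w := fun e => h.2 c₀ (by simp) (by simp [e])
  have hwt : w ≠ t := fun e => h'.2 w (by simp) (by simp [e])
  have ht1 : t ∉ r.map Prod.fst := by
    have := h'.1; rw [e₂, List.nodup_cons] at this; exact this.1
  have ht2 : t ∉ r.map Prod.snd := fun hm =>
    h'.2 t (by rw [e₁]; simp [hm]) (by simp)
  have hw1 : w ∉ r.map Prod.fst := fun hm =>
    h.2 w (by simp only [List.mem_cons, hm, or_true]) (by simp)
  have hw2 : w ∉ r.map Prod.snd := (List.nodup_cons.1 h.1).1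
  have key : ∀ w a q t : Fin 2, t + (w + a) * q + w * q = t + a * q := by decide
  have key' : ∀ a b : Fin 2, a + b + b = a := by decide
  have assoc : ∀ a b c : Fin 2, a * b * c = a * (b * c) := by decide
  simp only [mcxOne, run_append, run_mcx h, run_mcx h', e₁, conj_update_of_notMem ht1,
    conj_update_of_notMem ht2, conj_update_of_notMem hw1, conj_update_of_notMem hw2,
    Function.update_self, Function.update_of_ne hcw, Function.update_of_ne hc,
    Function.update_of_ne hwt, Function.update_of_ne hwt.symm, key, key', assoc]
  rw [Function.update_comm hwt]
  simp [Function.update_comm hwt, hwt]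

theorem classicalWithin_chain (t c₀ : Fin (n + 2)) (r : List (Fin (n + 2) × Fin (n + 2))) :
    ClassicalWithin (chain t c₀ r) (2 * r.length + 1) := by
  induction r generalizing t with
  | nil => exact classicalWithin_cn _ _
  | cons p r ih =>
    refine ((classicalWithin_tof _ _ _).append
      ((ih p.2).append (classicalWithin_tof _ _ _))).mono ?_
    simp only [List.length_cons]; omega

theorem classicalWithin_mcx (t c₀ : Fin (n + 2)) (r : List (Fin (n + 2) × Fin (n + 2))) :
    ClassicalWithin (mcx t c₀ r) (4 * r.length + 1) := by
  cases r with
  | nil => exact classicalWithin_cn _ _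
  | cons p r =>
    refine ((classicalWithin_chain _ _ _).append (classicalWithin_chain _ _ _)).mono ?_
    simp only [List.length_cons]; omega

theorem classicalWithin_mcxOne (t c₀ w : Fin (n + 2)) (r : List (Fin (n + 2) × Fin (n + 2))) :
    ClassicalWithin (mcxOne t c₀ w r) (16 * r.length + 4) := by
  have h := (classicalWithin_mcx w c₀ r).append (classicalWithin_mcx t w (r.map Prod.swap))
  refine (h.append h).mono ?_
  simp only [List.length_map]; omega

/-! ### Arithmetic circuits -/

/-- The number with the given binary digits, the least significant one first. -/
def lval (s : Basis (n + 2)) : List (Fin (n + 2)) → ℕ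
  | [] => 0
  | q :: l => s q + 2 * lval s l

theorem lval_congr {s s' : Basis (n + 2)} {l : List (Fin (n + 2))} (h : ∀ q ∈ l, s q = s' q) :
    lval s l = lval s' l := by
  induction l with
  | nil => rfl
  | cons q l ih =>
    simp only [List.mem_cons, forall_eq_or_imp] at h
    simp [lval, h.1, ih h.2]

theorem lval_lt (s : Basis (n + 2)) (l : List (Fin (n + 2))) : lval s l < 2 ^ l.length := by
  induction l with
  | nil => simp [lval]
  | cons q l ih =>
    have := (s q).isLt
    simp only [lval, List.length_cons, pow_succ]; omega

/-- The ripple-carry adder of Cuccaro, Draper, Kutin and Moulton: adds the number in the second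
components and the carry bit `c` to the number in the first components. -/
def adder : List (Fin (n + 2) × Fin (n + 2)) → Fin (n + 2) → List (Gate n)
  | [], _ => []
  | p :: r, c => (cn p.2 p.1 ++ cn p.2 c ++ tof c p.1 p.2) ++
      (adder r p.2 ++ (tof c p.1 p.2 ++ cn p.2 c ++ cn c p.1))

theorem classicalWithin_adder (r : List (Fin (n + 2) × Fin (n + 2))) (c : Fin (n + 2)) :
    ClassicalWithin (adder r c) (6 * r.length) := by
  induction r generalizing c with
  | nil => exact classicalWithin_nil _
  | cons p r ih =>
    refine ((((classicalWithin_cn _ _).append (classicalWithin_cn _ _)).append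
      (classicalWithin_tof _ _ _)).append ((ih p.2).append
      (((classicalWithin_tof _ _ _).append (classicalWithin_cn _ _)).append
      (classicalWithin_cn _ _)))).mono ?_
    simp only [List.length_cons]; omega

/-- On the way in, the majority of the two digits and the carry is written onto the digit `g` of the
second number, which is the carry for the next position. On the way out it is removed and the sum
digit is left in `v`. The last carry is dropped, hence a congruence; stating it in `ℤ` allows the
reversed adder to be read as subtraction. -/
theorem run_adder {r : List (Fin (n + 2) × Fin (n + 2))} {c : Fin (n + 2)}
    (h : (c :: (r.map Prod.fst ++ r.map Prod.snd)).Nodup) (s : Basis (n + 2)) :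
    (∀ q ∉ r.map Prod.fst, run (adder r c) s q = s q) ∧
      (lval (run (adder r c) s) (r.map Prod.fst) : ℤ) ≡
        lval s (r.map Prod.fst) + lval s (r.map Prod.snd) + (s c : ℕ) [ZMOD 2 ^ r.length] := by
  induction r generalizing c s with
  | nil => simp [adder, lval, Int.modEq_one]
  | cons p r ih =>
    obtain ⟨v, g⟩ := p
    have h' : (g :: (r.map Prod.fst ++ r.map Prod.snd)).Nodup := by
      simp only [List.map_cons, List.cons_append, List.nodup_cons, List.mem_cons,
        List.mem_append, not_or, List.nodup_append] at h ⊢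
      grind
    simp only [List.map_cons, List.cons_append, List.nodup_cons, List.mem_cons,
      List.mem_append, not_or] at h
    obtain ⟨⟨hcv, hcr, hcg, hcr'⟩, ⟨hvr, hvg, hvr'⟩, hn⟩ := h
    obtain ⟨hgr, hgr'⟩ : g ∉ r.map Prod.fst ∧ g ∉ r.map Prod.snd := by
      simpa only [List.mem_append, not_or] using (List.nodup_cons.1 h').1
    obtain ⟨s₁, hs₁⟩ : ∃ s₁, s₁ = run (cn g v ++ cn g c ++ tof c v g) s := ⟨_, rfl⟩
    have hs₁v : s₁ v = s v + s g := by
      simp [hs₁, run_append, run_cn, run_tof, hvg, Ne.symm hvg, hcv, Ne.symm hcv, hcg, Ne.symm hcg]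
    have hs₁c : s₁ c = s c + s g := by
      simp [hs₁, run_append, run_cn, run_tof, hvg, Ne.symm hvg, hcv, Ne.symm hcv, hcg, Ne.symm hcg]
    have hs₁g : s₁ g = s g + (s c + s g) * (s v + s g) := by
      simp [hs₁, run_append, run_cn, run_tof, hvg, Ne.symm hvg, hcv, Ne.symm hcv, hcg, Ne.symm hcg]
    have hs₁q : ∀ q, q ≠ v → q ≠ c → q ≠ g → s₁ q = s q := fun q h₁ h₂ h₃ => by
      simp [hs₁, run_append, run_cn, run_tof, hvg, Ne.symm hvg, hcv, Ne.symm hcv, hcg, Ne.symm hcg,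
        h₁, h₂, h₃]
    obtain ⟨i₁, i₂⟩ := ih h' s₁
    obtain ⟨s₂, hs₂⟩ : ∃ s₂, s₂ = run (adder r g) s₁ := ⟨_, rfl⟩
    obtain ⟨s₃, hs₃⟩ : ∃ s₃, s₃ = run (tof c v g ++ cn g c ++ cn c v) s₂ := ⟨_, rfl⟩
    have hrun : run (adder ((v, g) :: r) c) s = s₃ := by
      simp only [adder, run_append, hs₃, hs₂, hs₁]
    rw [← hs₂] at i₁ i₂
    -- The recursive call changes only the later first components, so the second Toffoli gate sees
    -- the same controls and restores `g`.
    have k₁ : ∀ v g c : Fin 2, g + (c + g) * (v + g) + (c + g) * (v + g) = g := by decide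
    have k₂ : ∀ a b : Fin 2, a + b + b = a := by decide
    have hs₃v : s₃ v = s v + s g + s c := by
      simp [hs₃, run_append, run_cn, run_tof, hvg, hcv, Ne.symm hcv, hcg, Ne.symm hcg,
        i₁ v hvr, i₁ c hcr, i₁ g hgr, hs₁v, hs₁c, hs₁g, k₁, k₂]
    have hs₃c : s₃ c = s c := by
      simp [hs₃, run_append, run_cn, run_tof, hvg, hcv, Ne.symm hcv, hcg, Ne.symm hcg,
        i₁ v hvr, i₁ c hcr, i₁ g hgr, hs₁v, hs₁c, hs₁g, k₁, k₂]
    have hs₃g : s₃ g = s g := by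
      simp [hs₃, run_append, run_cn, run_tof, hvg, Ne.symm hvg, hcv, Ne.symm hcv, hcg, Ne.symm hcg,
        i₁ v hvr, i₁ c hcr, i₁ g hgr, hs₁v, hs₁c, hs₁g, k₁, k₂]
    have hs₃q : ∀ q, q ≠ v → q ≠ c → q ≠ g → s₃ q = s₂ q := fun q h₁ h₂ h₃ => by
      simp [hs₃, run_append, run_cn, run_tof, hvg, hcv, Ne.symm hcv, hcg, Ne.symm hcg,
        h₁, h₂, h₃]
    rw [hrun]
    refine ⟨fun q hq => ?_, ?_⟩
    · simp only [List.map_cons, List.mem_cons, not_or] at hq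
      by_cases hqc : q = c
      · rw [hqc, hs₃c]
      by_cases hqg : q = g
      · rw [hqg, hs₃g]
      rw [hs₃q q hq.1 hqc hqg, i₁ q hq.2, hs₁q q hq.1 hqc hqg]
    · have ne_of : ∀ {q a : Fin (n + 2)} {l : List (Fin (n + 2))}, q ∈ l → a ∉ l → q ≠ a :=
        fun hq ha e => ha (e ▸ hq)
      have e₃ : lval s₃ (r.map Prod.fst) = lval s₂ (r.map Prod.fst) := lval_congr fun q hq =>
        hs₃q q (ne_of hq hvr) (ne_of hq hcr) (ne_of hq hgr)
      have e₁ : lval s₁ (r.map Prod.fst) = lval s (r.map Prod.fst) := lval_congr fun q hq =>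
        hs₁q q (ne_of hq hvr) (ne_of hq hcr) (ne_of hq hgr)
      have e₁' : lval s₁ (r.map Prod.snd) = lval s (r.map Prod.snd) := lval_congr fun q hq =>
        hs₁q q (ne_of hq hvr') (ne_of hq hcr') (ne_of hq hgr')
      rw [e₁, e₁', hs₁g] at i₂
      have i₃ := (Int.ModEq.mul_left' (c := 2) i₂).add_left ((s v + s g + s c : Fin 2) : ℕ)
      -- The full adder: the sum bit plus twice the majority bit is the number of ones.
      have carry : ∀ v g c : Fin 2, ((v + g + c : Fin 2) : ℕ) +
          2 * ((g + (c + g) * (v + g) : Fin 2) : ℕ) = (v : ℕ) + g + c := by decide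
      have carry' := carry (s v) (s g) (s c)
      simp only [List.map_cons, lval, List.length_cons, e₃, hs₃v, pow_succ']
      push_cast
      convert i₃ using 1
      zify at carry'
      linarith

/-- If `w` is `0`, flips all qubits of the list. -/
def flipUnless (w : Fin (n + 2)) : List (Fin (n + 2)) → List (Gate n)
  | [] => []
  | q :: l => [.x q] ++ cn w q ++ flipUnless w l

/-- If `w` is `1`, flips all qubits of the list. -/
def flipIf (w : Fin (n + 2)) : List (Fin (n + 2)) → List (Gate n)
  | [] => []
  | q :: l => cn w q ++ flipIf w l

/-- Flips all qubits of the list. -/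
def flipList : List (Fin (n + 2)) → List (Gate n)
  | [] => []
  | q :: l => [.x q] ++ flipList l

theorem classicalWithin_flipUnless (w : Fin (n + 2)) (l : List (Fin (n + 2))) :
    ClassicalWithin (flipUnless w l) (2 * l.length) := by
  induction l with
  | nil => exact classicalWithin_nil _
  | cons q l ih =>
    refine (((classicalWithin_x _).append (classicalWithin_cn _ _)).append ih).mono ?_
    simp only [List.length_cons]; omega

theorem classicalWithin_flipIf (w : Fin (n + 2)) (l : List (Fin (n + 2))) :
    ClassicalWithin (flipIf w l) l.length := by
  induction l with
  | nil => exact classicalWithin_nil _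
  | cons q l ih =>
    refine ((classicalWithin_cn _ _).append ih).mono ?_
    simp only [List.length_cons]; omega

theorem classicalWithin_flipList (l : List (Fin (n + 2))) :
    ClassicalWithin (flipList l) l.length := by
  induction l with
  | nil => exact classicalWithin_nil _
  | cons q l ih =>
    refine ((classicalWithin_x _).append ih).mono ?_
    simp only [List.length_cons]; omega

theorem run_flipUnless {w : Fin (n + 2)} {l : List (Fin (n + 2))} (h : (w :: l).Nodup)
    (s : Basis (n + 2)) (q : Fin (n + 2)) :
    run (flipUnless w l) s q = if q ∈ l then s q + 1 + s w else s q := by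
  induction l generalizing s with
  | nil => simp [flipUnless]
  | cons a l ih =>
    simp only [List.nodup_cons, List.mem_cons, not_or] at h
    obtain ⟨⟨hwa, hwl⟩, hal, hl⟩ := h
    simp only [flipUnless, run_append, run_x, run_cn hwa, ih (List.nodup_cons.2 ⟨hwl, hl⟩),
      List.mem_cons]
    by_cases hq : q = a
    · subst hq; simp [hal, hwa]
    · simp [hq, hwa]

theorem run_flipIf {w : Fin (n + 2)} {l : List (Fin (n + 2))} (h : (w :: l).Nodup)
    (s : Basis (n + 2)) (q : Fin (n + 2)) :
    run (flipIf w l) s q = if q ∈ l then s q + s w else s q := by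
  induction l generalizing s with
  | nil => simp [flipIf]
  | cons a l ih =>
    simp only [List.nodup_cons, List.mem_cons, not_or] at h
    obtain ⟨⟨hwa, hwl⟩, hal, hl⟩ := h
    simp only [flipIf, run_append, run_cn hwa, ih (List.nodup_cons.2 ⟨hwl, hl⟩),
      List.mem_cons]
    by_cases hq : q = a
    · subst hq; simp [hal]
    · simp [hq, hwa]

theorem run_flipList {l : List (Fin (n + 2))} (h : l.Nodup)
    (s : Basis (n + 2)) (q : Fin (n + 2)) :
    run (flipList l) s q = if q ∈ l then s q + 1 else s q := by
  induction l generalizing s with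
  | nil => simp [flipList]
  | cons a l ih =>
    simp only [List.nodup_cons] at h
    simp only [flipList, run_append, run_x, ih h.2, List.mem_cons]
    by_cases hq : q = a
    · subst hq; simp [h.1]
    · simp [hq]

/-- Complementing all digits sends `v` to `-v - 1` modulo the power of two; this turns a subtraction
into an addition in `run_addBit`. -/
theorem lval_of_forall_add_one {s s' : Basis (n + 2)} {l : List (Fin (n + 2))}
    (h : ∀ q ∈ l, s' q = s q + 1) : lval s' l + lval s l + 1 = 2 ^ l.length := by
  induction l with
  | nil => simp [lval]
  | cons q l ih =>
    simp only [List.mem_cons, forall_eq_or_imp] at h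
    have key : ∀ a : Fin 2, ((a + 1 : Fin 2) : ℕ) + a = 1 := by decide
    have := key (s q)
    have := ih h.2
    simp only [lval, h.1, List.length_cons, pow_succ]; omega

/-! ### Adding a bit with an unknown addend and an unknown carry -/

/-- Adds a bit to the number in the first components of the pairs, where `T` adds the bit to the
borrowed qubit `w`. -/
def addBit (r : List (Fin (n + 2) × Fin (n + 2))) (w : Fin (n + 2)) (T : List (Gate n)) :
    List (Gate n) :=
  flipUnless w (r.map Prod.fst) ++ (adder r w ++ (T ++ ((adder r w).reverse ++
    (T ++ flipUnless w (r.map Prod.fst)))))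

/-- Adding `g + w` and then subtracting `g + w'`, where `w'` is the bit `w` XOR `a`, changes the
number by `w - w'`. This is `a` if `w = 1` and `-a` if `w = 0`; in the latter case the complements
before and after reverse the sign. The hypothesis on `T` covers every state that differs from `s`
only at `w` and in the modified number, because `T` runs while both may be altered. -/
theorem run_addBit {r : List (Fin (n + 2) × Fin (n + 2))} {w : Fin (n + 2)} {T : List (Gate n)}
    (h : (w :: (r.map Prod.fst ++ r.map Prod.snd)).Nodup) (a : Fin 2) (s : Basis (n + 2))
    (hT : ∀ s' : Basis (n + 2), (∀ q ∉ w :: r.map Prod.fst, s' q = s q) →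
      run T s' = Function.update s' w (s' w + a)) :
    (∀ q ∉ r.map Prod.fst, run (addBit r w T) s q = s q) ∧
      (lval (run (addBit r w T) s) (r.map Prod.fst) : ℤ) ≡
        lval s (r.map Prod.fst) + (a : ℕ) [ZMOD 2 ^ r.length] := by
  have hw : w ∉ r.map Prod.fst := by
    simp only [List.nodup_cons, List.mem_append, not_or] at h; exact h.1.1
  have hw' : w ∉ r.map Prod.snd := by
    simp only [List.nodup_cons, List.mem_append, not_or] at h; exact h.1.2
  have hdisj : ∀ q ∈ r.map Prod.snd, q ∉ r.map Prod.fst := fun q hq hq' =>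
    (List.nodup_append.1 (List.nodup_cons.1 h).2).2.2 q hq' q hq rfl
  have hfl : (w :: r.map Prod.fst).Nodup :=
    List.nodup_cons.2 ⟨hw, (List.nodup_append.1 (List.nodup_cons.1 h).2).1⟩
  obtain ⟨s₁, hs₁⟩ : ∃ t, t = run (flipUnless w (r.map Prod.fst)) s := ⟨_, rfl⟩
  obtain ⟨s₂, hs₂⟩ : ∃ t, t = run (adder r w) s₁ := ⟨_, rfl⟩
  obtain ⟨s₃, hs₃⟩ : ∃ t, t = run T s₂ := ⟨_, rfl⟩
  obtain ⟨s₄, hs₄⟩ : ∃ t, t = run (adder r w).reverse s₃ := ⟨_, rfl⟩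
  obtain ⟨s₅, hs₅⟩ : ∃ t, t = run T s₄ := ⟨_, rfl⟩
  obtain ⟨s₆, hs₆⟩ : ∃ t, t = run (flipUnless w (r.map Prod.fst)) s₅ := ⟨_, rfl⟩
  have hrun : run (addBit r w T) s = s₆ := by
    simp only [addBit, run_append, hs₆, hs₅, hs₄, hs₃, hs₂, hs₁]
  have f₁ : ∀ q, s₁ q = if q ∈ r.map Prod.fst then s q + 1 + s w else s q := fun q => by
    rw [hs₁, run_flipUnless hfl]
  have f₆ : ∀ q, s₆ q = if q ∈ r.map Prod.fst then s₅ q + 1 + s₅ w else s₅ q := fun q => by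
    rw [hs₆, run_flipUnless hfl]
  obtain ⟨g₂, v₂⟩ := run_adder h s₁
  obtain ⟨g₄, v₄⟩ := run_adder h s₄
  have e₄ : run (adder r w) s₄ = s₃ := by rw [hs₄, run_run_reverse]
  rw [← hs₂] at g₂ v₂
  rw [e₄] at g₄ v₄
  have hs₂' : ∀ q ∉ r.map Prod.fst, s₂ q = s q := fun q hq => by
    rw [g₂ q hq, f₁, if_neg hq]
  have hT₂ := hT s₂ fun q hq => hs₂' q fun hm => hq (List.mem_cons_of_mem _ hm)
  rw [← hs₃] at hT₂
  have hs₃w : s₃ w = s w + a := by rw [hT₂, Function.update_self, hs₂' w hw]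
  have hs₃q : ∀ q, q ≠ w → s₃ q = s₂ q := fun q hq => by rw [hT₂, Function.update_of_ne hq]
  have hs₄w : s₄ w = s w + a := by rw [← g₄ w hw, hs₃w]
  have hs₄q : ∀ q, q ≠ w → q ∉ r.map Prod.fst → s₄ q = s q := fun q hq hq' => by
    rw [← g₄ q hq', hs₃q q hq, hs₂' q hq']
  have hT₄ := hT s₄ fun q hq => by
    simp only [List.mem_cons, not_or] at hq
    exact hs₄q q hq.1 hq.2
  rw [← hs₅] at hT₄
  have key : ∀ a b : Fin 2, a + b + b = a := by decide
  have hs₅w : s₅ w = s w := by rw [hT₄, Function.update_self, hs₄w, key]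
  have hs₅q : ∀ q, q ≠ w → s₅ q = s₄ q := fun q hq => by rw [hT₄, Function.update_of_ne hq]
  have ne_w : ∀ q ∈ r.map Prod.fst, q ≠ w := fun q hq e => hw (e ▸ hq)
  have ne_w' : ∀ q ∈ r.map Prod.snd, q ≠ w := fun q hq e => hw' (e ▸ hq)
  rw [hrun]
  refine ⟨fun q hq => ?_, ?_⟩
  · rw [f₆, if_neg hq]
    by_cases hqw : q = w
    · rw [hqw, hs₅w]
    · rw [hs₅q q hqw, hs₄q q hqw hq]
  · have a₃ : lval s₃ (r.map Prod.fst) = lval s₂ (r.map Prod.fst) :=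
      lval_congr fun q hq => hs₃q q (ne_w q hq)
    have a₅ : lval s₅ (r.map Prod.fst) = lval s₄ (r.map Prod.fst) :=
      lval_congr fun q hq => hs₅q q (ne_w q hq)
    have b₁ : lval s₁ (r.map Prod.snd) = lval s (r.map Prod.snd) :=
      lval_congr fun q hq => by rw [f₁, if_neg (hdisj q hq)]
    have b₄ : lval s₄ (r.map Prod.snd) = lval s (r.map Prod.snd) :=
      lval_congr fun q hq => hs₄q q (ne_w' q hq) (hdisj q hq)
    have w₁ : s₁ w = s w := by rw [f₁, if_neg hw]
    rw [b₁, w₁] at v₂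
    rw [a₃, b₄, hs₄w] at v₄
    have v := v₄.symm.trans v₂
    have hlen : (r.map Prod.fst).length = r.length := by simp
    have bit : ∀ b : Fin 2, b = 0 ∨ b = 1 := by decide
    rw [Int.modEq_iff_dvd] at v ⊢
    rcases bit (s w) with hsw | hsw
    -- Case `w = 0`: the complemented number decreases by `a`, so the number increases by `a`.
    · have c₁ := lval_of_forall_add_one (s := s) (s' := s₁) (l := r.map Prod.fst)
        fun q hq => by rw [f₁, if_pos hq, hsw, add_zero]
      have c₆ := lval_of_forall_add_one (s := s₅) (s' := s₆) (l := r.map Prod.fst)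
        fun q hq => by rw [f₆, if_pos hq, hs₅w, hsw, add_zero]
      rw [a₅, hlen] at c₆
      rw [hlen] at c₁
      zify at c₁ c₆
      rw [hsw, zero_add] at v
      refine (dvd_neg.2 v).trans (dvd_of_eq ?_)
      simp only [Fin.val_zero, Nat.cast_zero]
      linarith
    -- Case `w = 1`: nothing is complemented, and the subtracted carry is `1 - a` instead of `1`.
    · have two : ∀ b : Fin 2, b + 1 + 1 = b := by decide
      have c₁ : lval s₁ (r.map Prod.fst) = lval s (r.map Prod.fst) := lval_congr fun q hq => by
        rw [f₁, if_pos hq, hsw, two]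
      have c₆ : lval s₆ (r.map Prod.fst) = lval s₅ (r.map Prod.fst) := lval_congr fun q hq => by
        rw [f₆, if_pos hq, hs₅w, hsw, two]
      rw [c₁, hsw] at v
      rw [c₆, a₅]
      have key2 : ∀ a : Fin 2, ((1 + a : Fin 2) : ℕ) + (a : ℕ) = 1 := by decide
      have := key2 a
      zify at this
      convert v using 1
      simp only [Fin.val_one, Nat.cast_one]
      linarith

theorem classicalWithin_addBit (r : List (Fin (n + 2) × Fin (n + 2))) (w : Fin (n + 2))
    {T : List (Gate n)} {B : ℕ} (hT : ClassicalWithin T B) :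
    ClassicalWithin (addBit r w T) (16 * r.length + 2 * B) := by
  have h := classicalWithin_flipUnless w (r.map Prod.fst)
  have h' := classicalWithin_adder r w
  refine (h.append (h'.append (hT.append (h'.reverse.append (hT.append h))))).mono ?_
  simp only [List.length_map]; omega

/-! ### The controlled increment and the multicontrolled gates on the data register -/

theorem lval_add_one_eq_iff (s : Basis (n + 2)) (l : List (Fin (n + 2))) :
    lval s l + 1 = 2 ^ l.length ↔ conj s l = 1 := by
  induction l with
  | nil => simp [lval, conj]
  | cons q l ih =>
    have key : ∀ a b : Fin 2, a * b = 1 ↔ (a : ℕ) = 1 ∧ b = 1 := by decide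
    rw [conj, key, ← ih, lval, List.length_cons, pow_succ]
    have := (s q).isLt
    omega

theorem lval_append (s : Basis (n + 2)) (l m : List (Fin (n + 2))) :
    lval s (l ++ m) = lval s l + 2 ^ l.length * lval s m := by
  induction l with
  | nil => simp [lval]
  | cons q l ih =>
    simp only [List.cons_append, lval, ih, List.length_cons, pow_succ]; ring

/-- The number at the qubits of `l` is incremented by the bit `a`, with wrap-around. -/
def Incremented (l : List (Fin (n + 2))) (s s' : Basis (n + 2)) (a : Fin 2) : Prop :=
  lval s' l + 2 ^ l.length * ((a * conj s l : Fin 2) : ℕ) = lval s l + a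

theorem incremented_of_modEq {l : List (Fin (n + 2))} {s s' : Basis (n + 2)} {a : Fin 2}
    (h : (lval s' l : ℤ) ≡ lval s l + (a : ℕ) [ZMOD 2 ^ l.length]) : Incremented l s s' a := by
  have h₁ := lval_lt s l
  have h₂ := lval_lt s' l
  have h₃ := lval_add_one_eq_iff s l
  have bit : ∀ b : Fin 2, b = 0 ∨ b = 1 := by decide
  have h' : lval s' l % 2 ^ l.length = (lval s l + a) % 2 ^ l.length := by
    have : lval s' l ≡ lval s l + a [MOD 2 ^ l.length] := by
      rw [← Int.natCast_modEq_iff]; push_cast; exact h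
    exact this
  rw [Nat.mod_eq_of_lt h₂] at h'
  unfold Incremented
  rcases bit a with ha | ha
  · simp only [ha, Fin.val_zero, add_zero, Nat.mod_eq_of_lt h₁] at h'
    simp [ha, h']
  · rcases bit (conj s l) with hc | hc
    · have : lval s l + 1 ≠ 2 ^ l.length := fun e => by
        rw [h₃, hc] at e; exact absurd e (by decide)
      rw [ha, Fin.val_one, Nat.mod_eq_of_lt (by omega)] at h'
      simp [ha, hc, h']
    · rw [ha, Fin.val_one, h₃.2 hc, Nat.mod_self] at h'
      simp [ha, hc, h', h₃.2 hc]

/-- The carry out of the low digits is `a` times their conjunction, since a bit overflows only a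
number whose digits are all `1`. -/
theorem Incremented.append {l m : List (Fin (n + 2))} {s s' : Basis (n + 2)} {a : Fin 2}
    (h : Incremented l s s' a) (h' : Incremented m s s' (a * conj s l)) :
    Incremented (l ++ m) s s' a := by
  unfold Incremented at *
  have assoc : ∀ a b c : Fin 2, a * b * c = a * (b * c) := by decide
  rw [lval_append, lval_append, conj_append, List.length_append, pow_add, ← assoc]
  linear_combination h + 2 ^ l.length * h'

theorem incremented_singleton {u : Fin (n + 2)} {s s' : Basis (n + 2)} {a : Fin 2}
    (h : s' u = s u + a) : Incremented [u] s s' a := by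
  have key : ∀ x a : Fin 2, ((x + a : Fin 2) : ℕ) + 2 * ((a * (x * 1) : Fin 2) : ℕ) = x + a := by
    decide
  simpa [Incremented, lval, conj, h] using key (s u) a

theorem exists_halves {α : Type*} (l : List α) :
    ∃ a b c : List α, l = a ++ b ++ c ∧ a.length = b.length ∧ (c = [] ∨ ∃ u, c = [u]) := by
  refine ⟨l.take (l.length / 2), (l.drop (l.length / 2)).take (l.length / 2),
    (l.drop (l.length / 2)).drop (l.length / 2), by simp [List.append_assoc], ?_, ?_⟩
  · simp only [List.length_take, List.length_drop]; omega
  · rw [← List.length_eq_zero_iff, ← List.length_eq_one_iff]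
    simp only [List.length_drop]; omega

theorem chainOK_zip {t c : Fin (n + 2)} {l m : List (Fin (n + 2))} (hlm : l.length = m.length)
    (h₁ : (t :: m).Nodup) (h₂ : ∀ q ∈ c :: l, q ∉ t :: m) : ChainOK t c (l.zip m) := by
  unfold ChainOK
  rw [List.map_fst_zip hlm.le, List.map_snd_zip hlm.ge]
  exact ⟨h₁, h₂⟩

/-- The high half `m` is treated first, because its incoming carry depends on the old value of the
low half `l`. Each half is the unknown addend for the other. The multicontrolled NOT that puts the
carry on `w` borrows `m`, although `m` is being modified at that time; this is harmless because `m`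
is restored whatever it contains. -/
theorem exists_increment_even {t w : Fin (n + 2)} {l m : List (Fin (n + 2))}
    (hlm : l.length = m.length) (h : (t :: w :: (l ++ m)).Nodup) :
    ∃ circ : List (Gate n), ClassicalWithin circ (40 * l.length + 4) ∧
      ∀ s, (∀ q ∉ l ++ m, run circ s q = s q) ∧ Incremented (l ++ m) s (run circ s) (s t) := by
  simp only [List.nodup_cons, List.mem_cons, List.mem_append, not_or, List.nodup_append] at h
  obtain ⟨⟨htw, htl, htm⟩, ⟨hwl, hwm⟩, hl, hm, hd⟩ := h
  have f₁ : (l.zip m).map Prod.fst = l := List.map_fst_zip hlm.le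
  have f₂ : (l.zip m).map Prod.snd = m := List.map_snd_zip hlm.ge
  have f₃ : (m.zip l).map Prod.fst = m := List.map_fst_zip hlm.ge
  have f₄ : (m.zip l).map Prod.snd = l := List.map_snd_zip hlm.le
  have n₁ : (m.zip l).length = m.length := by simp [hlm]
  have n₂ : (l.zip m).length = l.length := by simp [hlm]
  have ok : ChainOK w t (l.zip m) := chainOK_zip hlm (List.nodup_cons.2 ⟨hwm, hm⟩) (by
    intro q hq
    simp only [List.mem_cons, not_or] at hq ⊢
    rcases hq with rfl | hq
    · exact ⟨htw, htm⟩
    · exact ⟨fun e => hwl (e ▸ hq), fun hq' => hd q hq q hq' rfl⟩)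
  refine ⟨addBit (m.zip l) w (mcx w t (l.zip m)) ++ addBit (l.zip m) w (cn t w), ?_,
    fun s => ?_⟩
  · refine ((classicalWithin_addBit _ _ (classicalWithin_mcx _ _ _)).append
      (classicalWithin_addBit _ _ (classicalWithin_cn _ _))).mono ?_
    simp only [n₁, n₂]; omega
  · rw [run_append]
    obtain ⟨g₁, v₁⟩ := run_addBit (r := m.zip l) (w := w) (T := mcx w t (l.zip m)) (by
      rw [f₃, f₄]
      simp only [List.nodup_cons, List.mem_append, not_or, List.nodup_append]
      exact ⟨⟨hwm, hwl⟩, hm, hl, fun a ha b hb e => hd b hb a ha e.symm⟩)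
      (s t * conj s l) s (fun s' hs' => by
        rw [f₃] at hs'
        have e₁ : s' t = s t := hs' t (by simp only [List.mem_cons, not_or]; exact ⟨htw, htm⟩)
        have e₂ : conj s' l = conj s l := conj_congr fun q hq => hs' q (by
          simp only [List.mem_cons, not_or]
          exact ⟨fun e => hwl (e ▸ hq), fun hq' => hd q hq q hq' rfl⟩)
        rw [run_mcx ok, f₁, e₁, e₂])
    obtain ⟨s₁, hs₁⟩ : ∃ s₁, s₁ = run (addBit (m.zip l) w (mcx w t (l.zip m))) s := ⟨_, rfl⟩
    rw [← hs₁, f₃] at g₁ v₁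
    rw [← hs₁]
    obtain ⟨g₂, v₂⟩ := run_addBit (r := l.zip m) (w := w) (T := cn t w) (by
      rw [f₁, f₂]
      simp only [List.nodup_cons, List.mem_append, not_or, List.nodup_append]
      exact ⟨⟨hwl, hwm⟩, hl, hm, hd⟩)
      (s t) s₁ (fun s' hs' => by
        rw [f₁] at hs'
        rw [run_cn htw, hs' t (by simp only [List.mem_cons, not_or]; exact ⟨htw, htl⟩), g₁ t htm])
    obtain ⟨s₂, hs₂⟩ : ∃ s₂, s₂ = run (addBit (l.zip m) w (cn t w)) s₁ := ⟨_, rfl⟩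
    rw [← hs₂, f₁] at g₂ v₂
    rw [← hs₂]
    refine ⟨fun q hq => ?_, Incremented.append ?_ ?_⟩
    · simp only [List.mem_append, not_or] at hq
      rw [g₂ q hq.1, g₁ q hq.2]
    · apply incremented_of_modEq
      rw [n₂, lval_congr (s := s₁) (s' := s) fun q hq => g₁ q fun hq' => hd q hq q hq' rfl] at v₂
      exact v₂
    · apply incremented_of_modEq
      rw [n₁] at v₁
      rw [lval_congr (s := s₂) (s' := s₁) fun q hq => g₂ q fun hq' => hd q hq' q hq rfl]
      exact v₁

/-- Incrementing a register, controlled by `t` and with one borrowed qubit `w`, with linearly many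
gates. -/
theorem exists_increment {t w : Fin (n + 2)} {l : List (Fin (n + 2))}
    (h : (t :: w :: l).Nodup) :
    ∃ circ : List (Gate n), ClassicalWithin circ (28 * l.length + 8) ∧
      ∀ s, (∀ q ∉ l, run circ s q = s q) ∧ Incremented l s (run circ s) (s t) := by
  obtain ⟨a, b, c, rfl, hab, rfl | ⟨u, rfl⟩⟩ := exists_halves l
  · simp only [List.append_nil] at h ⊢
    obtain ⟨circ, hc, hs⟩ := exists_increment_even hab h
    exact ⟨circ, hc.mono (by simp only [List.length_append]; omega), hs⟩
  · have h' := h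
    simp only [List.nodup_cons, List.mem_cons, List.mem_append, not_or, List.nodup_append,
      List.not_mem_nil, or_false, List.nodup_nil, not_false_eq_true, true_and, and_true,
      forall_eq] at h
    obtain ⟨⟨htw, ⟨hta, htb⟩, htu⟩, ⟨⟨hwa, hwb⟩, hwu⟩, ⟨ha, hb, hd⟩, hu⟩ := h
    have hua : u ∉ a := fun hm => hu u (Or.inl hm) rfl
    have hub : u ∉ b := fun hm => hu u (Or.inr hm) rfl
    obtain ⟨circ, hc, hs⟩ := exists_increment_even (t := t) (w := w) hab (by
      simp only [List.nodup_cons, List.mem_cons, List.mem_append, not_or, List.nodup_append]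
      exact ⟨⟨htw, hta, htb⟩, ⟨hwa, hwb⟩, ha, hb, hd⟩)
    have ok : ChainOK w t (a.zip b) := chainOK_zip hab (List.nodup_cons.2 ⟨hwb, hb⟩) (by
      intro q hq
      simp only [List.mem_cons, not_or] at hq ⊢
      rcases hq with rfl | hq
      · exact ⟨htw, htb⟩
      · exact ⟨fun e => hwa (e ▸ hq), fun hq' => hd q hq q hq' rfl⟩)
    have ok' : ChainOK u w ((a.zip b).map Prod.swap) := by
      rw [List.zip_swap]
      refine chainOK_zip hab.symm (List.nodup_cons.2 ⟨hua, ha⟩) fun q hq => ?_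
      simp only [List.mem_cons, not_or] at hq ⊢
      rcases hq with rfl | hq
      · exact ⟨hwu, hwa⟩
      · exact ⟨fun e => hub (e ▸ hq), fun hq' => hd q hq' q hq rfl⟩
    -- For odd length the top digit `u` is flipped first, while the carry from the lower digits can
    -- still be read off their old values.
    refine ⟨mcxOne u t w (a.zip b) ++ circ,
      ((classicalWithin_mcxOne _ _ _ _).append hc).mono (by
        simp only [List.length_append, List.length_zip, List.length_cons]; omega), fun s => ?_⟩
    obtain ⟨s₁, hs₁⟩ : ∃ s₁, s₁ = run (mcxOne u t w (a.zip b)) s := ⟨_, rfl⟩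
    rw [run_append, ← hs₁]
    rw [run_mcxOne ok ok' htu, List.map_fst_zip hab.le, List.map_snd_zip hab.ge,
      ← conj_append] at hs₁
    obtain ⟨g, v⟩ := hs s₁
    have hq₁ : ∀ q, q ≠ u → s₁ q = s q := fun q hq => by rw [hs₁, Function.update_of_ne hq]
    refine ⟨fun q hq => ?_, Incremented.append ?_ ?_⟩
    · simp only [List.mem_append, List.mem_singleton, not_or] at hq
      rw [g q (by simpa using hq.1), hq₁ q hq.2]
    · have hab' : ∀ q ∈ a ++ b, s₁ q = s q := fun q hq => hq₁ q fun e => by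
        subst e; rcases List.mem_append.1 hq with hq | hq
        exacts [hua hq, hub hq]
      unfold Incremented at v ⊢
      rwa [conj_congr hab', lval_congr hab', hq₁ t htu] at v
    · apply incremented_singleton
      rw [g u (by simp [hua, hub]), hs₁, Function.update_self]

/-- The multicontrolled `NOT` with one borrowed qubit `w`, with linearly many gates. -/
theorem exists_mcx {t w : Fin (n + 2)} {l : List (Fin (n + 2))} (hl : l ≠ [])
    (h : (t :: w :: l).Nodup) :
    ∃ circ : List (Gate n), ClassicalWithin circ (8 * l.length + 4) ∧
      ∀ s, run circ s = Function.update s t (s t + conj s l) := by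
  obtain ⟨a, b, c, rfl, hab, hc⟩ := exists_halves l
  -- `mcxOne` needs one control besides the pairs. It is the unpaired qubit for odd length; for even
  -- length a qubit of `a` is used twice, which is harmless since bits are idempotent.
  obtain ⟨v, hv⟩ : ∃ v, v ∈ a ++ c ∧ v ∉ b ∧
      ∀ s : Basis (n + 2), s v * (conj s a * conj s b) = conj s (a ++ b ++ c) := by
    rcases hc with rfl | ⟨u, rfl⟩
    · cases a with
      | nil =>
        have : b = [] := List.length_eq_zero_iff.1 hab.symm
        simp [this] at hl
      | cons u a =>
        have key : ∀ a b c : Fin 2, a * (a * b * c) = a * (b * c) := by decide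
        refine ⟨u, by simp, ?_, fun s => by simp [conj, conj_append, key]⟩
        simp only [List.cons_append, List.nodup_cons, List.mem_cons, List.mem_append, not_or] at h
        tauto
    · have key : ∀ a b c : Fin 2, a * (b * c) = b * c * a := by decide
      refine ⟨u, by simp, fun hm => ?_, fun s => ?_⟩
      · simp only [List.nodup_cons, List.nodup_append] at h
        exact h.2.2.2.2 u (List.mem_append_right _ hm) u (by simp) rfl
      · have : ∀ a : Fin 2, a * 1 = a := by decide
        rw [conj_append, conj_append, conj, conj, key, this]
  obtain ⟨hv, hvb, hs⟩ := hv
  simp only [List.nodup_cons, List.mem_cons, List.mem_append, not_or, List.nodup_append] at h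
  obtain ⟨⟨htw, ⟨hta, htb⟩, htc⟩, ⟨⟨hwa, hwb⟩, hwc⟩, ⟨ha, hb, hd⟩, -, -⟩ := h
  have hvt : v ≠ t := by
    rintro rfl; rcases List.mem_append.1 hv with hv | hv
    exacts [hta hv, htc hv]
  have hvw : v ≠ w := by
    rintro rfl; rcases List.mem_append.1 hv with hv | hv
    exacts [hwa hv, hwc hv]
  have ok : ChainOK w v (a.zip b) := chainOK_zip hab (List.nodup_cons.2 ⟨hwb, hb⟩) (by
    intro q hq
    simp only [List.mem_cons, not_or] at hq ⊢
    rcases hq with rfl | hq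
    · exact ⟨hvw, hvb⟩
    · exact ⟨fun e => hwa (e ▸ hq), fun hq' => hd q hq q hq' rfl⟩)
  have ok' : ChainOK t w ((a.zip b).map Prod.swap) := by
    rw [List.zip_swap]
    refine chainOK_zip hab.symm (List.nodup_cons.2 ⟨hta, ha⟩) fun q hq => ?_
    simp only [List.mem_cons, not_or] at hq ⊢
    rcases hq with rfl | hq
    · exact ⟨fun e => htw e.symm, hwa⟩
    · exact ⟨fun e => htb (e ▸ hq), fun hq' => hd q hq' q hq rfl⟩
  refine ⟨mcxOne t v w (a.zip b), (classicalWithin_mcxOne _ _ _ _).mono (by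
    simp only [List.length_append, List.length_zip]; omega), fun s => ?_⟩
  rw [run_mcxOne ok ok' hvt, List.map_fst_zip hab.le, List.map_snd_zip hab.ge, hs]

/-! ### Operators -/

theorem tensor_apply {k : ℕ} (M : Fin k → Matrix (Fin 2) (Fin 2) ℂ) (x y : Basis k) :
    tensor M x y = ∏ i, M i (x i) (y i) := rfl

theorem onQubit_apply {k : ℕ} (q : Fin k) (M : Matrix (Fin 2) (Fin 2) ℂ) (x y : Basis k) :
    onQubit q M x y = if ∀ i, i ≠ q → x i = y i then M (x q) (y q) else 0 := by
  rw [onQubit, tensor_apply, ← Finset.mul_prod_erase _ _ (Finset.mem_univ q)]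
  simp only [if_true]
  split_ifs with h
  · rw [Finset.prod_eq_one, mul_one]
    intro i hi
    have hi := Finset.ne_of_mem_erase hi
    rw [if_neg hi, h i hi, Matrix.one_apply_eq]
  · push Not at h
    obtain ⟨i, hi, hxy⟩ := h
    rw [Finset.prod_eq_zero (Finset.mem_erase.2 ⟨hi, Finset.mem_univ i⟩), mul_zero]
    rw [if_neg hi, Matrix.one_apply_ne hxy]

theorem onQubit_eq_zero {k : ℕ} {q : Fin k} {M : Matrix (Fin 2) (Fin 2) ℂ} {x y : Basis k}
    (h : ∀ b, y ≠ Function.update x q b) : onQubit q M x y = 0 := by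
  rw [onQubit_apply, if_neg]
  intro hxy
  refine h (y q) (funext fun i => ?_)
  by_cases hi : i = q
  · subst hi; simp
  · simp [hi, hxy i hi]

theorem onQubit_update_apply {k : ℕ} (q : Fin k) (M : Matrix (Fin 2) (Fin 2) ℂ) (x : Basis k)
    (b : Fin 2) : onQubit q M x (Function.update x q b) = M (x q) b := by
  rw [onQubit_apply, if_pos fun i hi => by simp [hi]]; simp

theorem onQubit_update_apply' {k : ℕ} (q : Fin k) (M : Matrix (Fin 2) (Fin 2) ℂ) (x : Basis k)
    (b : Fin 2) : onQubit q M (Function.update x q b) x = M b (x q) := by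
  rw [onQubit_apply, if_pos fun i hi => by simp [hi]]; simp

/-- A single-qubit operator couples a basis state only to the two states that agree with it off `q`;
this reduces products with such operators to two terms. -/
theorem sum_eq_sum_update {k : ℕ} (q : Fin k) (x : Basis k) (F : Basis k → ℂ)
    (h : ∀ z, (∀ b, z ≠ Function.update x q b) → F z = 0) :
    ∑ z, F z = ∑ b, F (Function.update x q b) := by
  classical
  rw [← Finset.sum_image (s := Finset.univ) (g := fun b => Function.update x q b)
    (fun a _ b _ hab => by simpa using congrFun hab q)]
  refine (Finset.sum_subset (Finset.subset_univ _) fun z _ hz => h z fun b e => hz ?_).symm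
  exact Finset.mem_image.2 ⟨b, Finset.mem_univ b, e.symm⟩

theorem onQubit_mul_apply {k : ℕ} (q : Fin k) (M : Matrix (Fin 2) (Fin 2) ℂ) (A : Op k)
    (x y : Basis k) :
    (onQubit q M * A) x y = ∑ b, M (x q) b * A (Function.update x q b) y := by
  rw [Matrix.mul_apply, sum_eq_sum_update q x _ fun z hz => by rw [onQubit_eq_zero hz, zero_mul]]
  simp only [onQubit_update_apply]

theorem mul_onQubit_apply {k : ℕ} (q : Fin k) (M : Matrix (Fin 2) (Fin 2) ℂ) (A : Op k)
    (x y : Basis k) :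
    (A * onQubit q M) x y = ∑ b, A x (Function.update y q b) * M b (y q) := by
  rw [Matrix.mul_apply, sum_eq_sum_update q y _ fun z hz => ?_]
  · simp only [onQubit_update_apply']
  · rw [onQubit_eq_zero, mul_zero]
    intro b hb
    refine hz (z q) ?_
    rw [hb]; simp

theorem hadamard_mul_hadamard : hadamard * hadamard = 1 := by
  have h2 : ((1 / Real.sqrt 2 : ℝ) : ℂ) * ((1 / Real.sqrt 2 : ℝ) : ℂ) = 1 / 2 := by
    rw [← Complex.ofReal_mul, div_mul_div_comm, Real.mul_self_sqrt (by norm_num)]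
    push_cast; norm_num
  rw [hadamard, Matrix.smul_mul, Matrix.mul_smul, smul_smul, h2]
  ext i j
  fin_cases i <;> fin_cases j <;> norm_num [Matrix.mul_apply, Fin.sum_univ_two]

theorem onQubit_mul_onQubit {k : ℕ} (q : Fin k) (M M' : Matrix (Fin 2) (Fin 2) ℂ) :
    onQubit q M * onQubit q M' = onQubit q (M * M') := by
  ext x y
  rw [onQubit_mul_apply, onQubit_apply, Matrix.mul_apply]
  simp only [onQubit_apply]
  have : ∀ b, (∀ i, i ≠ q → Function.update x q b i = y i) ↔ ∀ i, i ≠ q → x i = y i := fun b =>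
    forall_congr' fun i => forall_congr' fun hi => by rw [Function.update_of_ne hi]
  simp only [this]
  split_ifs <;> simp

theorem onQubit_one {k : ℕ} (q : Fin k) : onQubit q 1 = 1 := by
  ext x y
  rw [onQubit_apply, Matrix.one_apply, Matrix.one_apply, ← ite_and]
  congr 1
  rw [eq_iff_iff, funext_iff]
  refine ⟨fun h i => ?_, fun h => ⟨fun i _ => h i, h q⟩⟩
  by_cases hi : i = q
  · rw [hi, h.2]
  · exact h.1 i hi

theorem onQubit_hadamard_mul_self {k : ℕ} (q : Fin k) :
    onQubit q hadamard * onQubit q hadamard = 1 := by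
  rw [onQubit_mul_onQubit, hadamard_mul_hadamard, onQubit_one]

theorem conjTranspose_onQubit {k : ℕ} (q : Fin k) (M : Matrix (Fin 2) (Fin 2) ℂ) :
    (onQubit q M)ᴴ = onQubit q Mᴴ := by
  ext x y
  rw [Matrix.conjTranspose_apply, onQubit_apply, onQubit_apply]
  have : (∀ i, i ≠ q → y i = x i) ↔ ∀ i, i ≠ q → x i = y i :=
    forall_congr' fun i => forall_congr' fun _ => eq_comm
  simp only [this]
  split_ifs <;> simp

theorem conjTranspose_hadamard : hadamardᴴ = hadamard := by
  ext i j
  fin_cases i <;> fin_cases j <;> simp [hadamard]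

/-! ### From classical circuits to operators -/

/-- The operator of a map of basis states. -/
noncomputable def mapOp {ι : Type*} [DecidableEq ι] (g : ι → ι) : Matrix ι ι ℂ :=
  Matrix.of fun x y => if x = g y then 1 else 0

theorem mapOp_apply {ι : Type*} [DecidableEq ι] (g : ι → ι) (x y : ι) :
    mapOp g x y = if x = g y then 1 else 0 := rfl

theorem mul_mapOp_apply {ι : Type*} [Fintype ι] [DecidableEq ι] (A : Matrix ι ι ℂ) (g : ι → ι)
    (x y : ι) : (A * mapOp g) x y = A x (g y) := by
  simp [Matrix.mul_apply, mapOp_apply]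

theorem mapOp_mul_mapOp {ι : Type*} [Fintype ι] [DecidableEq ι] (g g' : ι → ι) :
    mapOp g * mapOp g' = mapOp (g ∘ g') := by
  ext x y; rw [mul_mapOp_apply]; rfl

theorem mapOp_id {ι : Type*} [DecidableEq ι] : mapOp (id : ι → ι) = 1 := by
  ext x y; simp [mapOp_apply, Matrix.one_apply]

theorem conjTranspose_mapOp {ι : Type*} [DecidableEq ι] {g g' : ι → ι}
    (h : ∀ x, g (g' x) = x) (h' : ∀ x, g' (g x) = x) : (mapOp g)ᴴ = mapOp g' := by
  ext x y
  rw [Matrix.conjTranspose_apply, mapOp_apply, mapOp_apply]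
  have : y = g x ↔ x = g' y := ⟨fun e => by rw [e, h'], fun e => by rw [e, h]⟩
  simp only [this]
  split_ifs <;> simp

theorem circuitOp_append (V U : Op n) (l m : List (Gate n)) :
    circuitOp V U (l ++ m) = circuitOp V U m * circuitOp V U l := by
  induction l with
  | nil => simp [circuitOp]
  | cons g l ih => simp [circuitOp, ih, mul_assoc]

theorem Gate.op_eq_mapOp {g : Gate n} (h : g.IsClassical) (V U : Op n) :
    g.op V U = mapOp g.act := by
  have k₁ : ∀ a : Fin 2, 1 - a = a + 1 := by decide
  have k₂ : ∀ a b : Fin 2, b ≠ 1 → a + b = a := by decide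
  have k₃ : ∀ a b c : Fin 2, ¬ (b = 1 ∧ c = 1) → a + b * c = a := by decide
  have k₄ : (1 : Fin 2) * 1 = 1 := by decide
  cases g with
  | x q =>
    ext x y
    have kx : ∀ a b : Fin 2, pauliX a b = if a = b + 1 then 1 else 0 := by
      intro a b; fin_cases a <;> fin_cases b <;> simp [pauliX]
    rw [Gate.op, onQubit_apply, mapOp_apply, kx, ← ite_and]
    congr 1
    simp only [Gate.act, eq_iff_iff]
    constructor
    · rintro ⟨h₁, h₂⟩
      ext i
      by_cases hi : i = q
      · subst hi; simp [h₂]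
      · simp [hi, h₁ i hi]
    · rintro rfl
      exact ⟨fun i hi => by simp [hi], by simp⟩
  | cnot c t hct =>
    ext x y
    simp only [Gate.op, ctrlNot, Matrix.of_apply, mapOp_apply, Gate.act, Finset.mem_singleton,
      forall_eq, flip]
    by_cases hc : y c = 1
    · simp [hc, k₁]
    · simp [hc, k₂]
  | toffoli c₁ c₂ t _ _ _ =>
    ext x y
    simp only [Gate.op, ctrlNot, Matrix.of_apply, mapOp_apply, Gate.act, Finset.mem_insert,
      Finset.mem_singleton, forall_eq_or_imp, forall_eq, flip]
    by_cases hc : y c₁ = 1 ∧ y c₂ = 1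
    · simp [hc, k₁, k₄]
    · have e : Function.update y t (y t + y c₁ * y c₂) = y := by
        rw [k₃ _ _ _ hc, Function.update_eq_self]
      simp only [if_neg hc, e]
  | _ => exact h.elim

theorem circuitOp_eq_mapOp {l : List (Gate n)} (h : ∀ g ∈ l, g.IsClassical) (V U : Op n) :
    circuitOp V U l = mapOp (run l) := by
  induction l with
  | nil => exact mapOp_id.symm
  | cons g l ih =>
    simp only [List.mem_cons, forall_eq_or_imp] at h
    rw [circuitOp, ih h.2, Gate.op_eq_mapOp h.1, mapOp_mul_mapOp]; rfl

theorem conjTranspose_mapOp_run (l : List (Gate n)) :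
    (mapOp (run l))ᴴ = mapOp (run l.reverse) :=
  conjTranspose_mapOp (run_run_reverse l) (run_reverse_run l)

/-! ### The data register -/

/-- The basis state with the given parts. -/
def mk (b : Fin 2) (d : Basis n) (w : Fin 2) : Basis (n + 2) :=
  Fin.snoc (α := fun _ => Fin 2) (Fin.cons (α := fun _ => Fin 2) b d) w

@[simp] theorem mk_zero (b : Fin 2) (d : Basis n) (w : Fin 2) : mk b d w 0 = b := by
  have : (0 : Fin (n + 2)) = (0 : Fin (n + 1)).castSucc := rfl
  rw [mk, this, Fin.snoc_castSucc, Fin.cons_zero]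

@[simp] theorem mk_last (b : Fin 2) (d : Basis n) (w : Fin 2) :
    mk b d w (Fin.last (n + 1)) = w := by
  rw [mk, Fin.snoc_last]

@[simp] theorem dataPart_mk (b : Fin 2) (d : Basis n) (w : Fin 2) : dataPart (mk b d w) = d := by
  ext i; rw [dataPart, dataQubit, mk, Fin.snoc_castSucc, Fin.cons_succ]

theorem forall_qubit {p : Fin (n + 2) → Prop} :
    (∀ q, p q) ↔ p 0 ∧ (∀ i, p (dataQubit i)) ∧ p (Fin.last (n + 1)) := by
  constructor
  · exact fun h => ⟨h _, fun i => h _, h _⟩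
  · rintro ⟨h₀, h₁, h₂⟩ q
    refine Fin.lastCases h₂ (fun q => ?_) q
    exact Fin.cases h₀ h₁ q

theorem basis_ext_iff {s s' : Basis (n + 2)} : s = s' ↔
    s 0 = s' 0 ∧ dataPart s = dataPart s' ∧ s (Fin.last (n + 1)) = s' (Fin.last (n + 1)) := by
  rw [funext_iff, forall_qubit, funext_iff]; rfl

theorem dataQubit_injective : Function.Injective (dataQubit (n := n)) := fun i j h => by
  simpa [dataQubit] using h

@[simp] theorem dataQubit_ne_zero (i : Fin n) : dataQubit i ≠ 0 := by
  intro h; simp [dataQubit, Fin.ext_iff] at h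

@[simp] theorem dataQubit_ne_last (i : Fin n) : dataQubit i ≠ Fin.last (n + 1) := by
  intro h
  have := i.isLt
  simp only [dataQubit, Fin.ext_iff, Fin.val_castSucc, Fin.val_succ, Fin.val_last] at h
  omega

/-- Basis states in terms of their parts. -/
def mkEquiv (n : ℕ) : Fin 2 × Basis n × Fin 2 ≃ Basis (n + 2) where
  toFun p := mk p.1 p.2.1 p.2.2
  invFun s := (s 0, dataPart s, s (Fin.last (n + 1)))
  left_inv p := by simp
  right_inv s := by rw [basis_ext_iff]; simp

theorem sum_basis {M : Type*} [AddCommMonoid M] (F : Basis (n + 2) → M) :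
    ∑ s, F s = ∑ b, ∑ d, ∑ w, F (mk b d w) := by
  rw [← (mkEquiv n).sum_comp, Fintype.sum_prod_type]
  simp only [Fintype.sum_prod_type]; rfl

/-- The operator that is `A₀` or `A₁` on the data register, according to the value of
qubit `0`. -/
noncomputable def blockOp (A₀ A₁ : Op n) : Op (n + 2) :=
  Matrix.of fun x y =>
    if x 0 = y 0 ∧ x (Fin.last (n + 1)) = y (Fin.last (n + 1))
    then (if y 0 = 1 then A₁ else A₀) (dataPart x) (dataPart y) else 0

theorem ctrlData_eq_blockOp (M : Op n) : ctrlData M = blockOp 1 M := rfl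

theorem onData_eq_blockOp (M : Op n) : onData M = blockOp M M := by
  ext x y; simp [onData, blockOp]

theorem blockOp_mul_blockOp (A₀ A₁ B₀ B₁ : Op n) :
    blockOp A₀ A₁ * blockOp B₀ B₁ = blockOp (A₀ * B₀) (A₁ * B₁) := by
  ext x y
  rw [Matrix.mul_apply, sum_basis]
  simp only [blockOp, Matrix.of_apply, mk_zero, mk_last, dataPart_mk]
  by_cases h : x 0 = y 0 ∧ x (Fin.last (n + 1)) = y (Fin.last (n + 1))
  · rw [if_pos h, Fintype.sum_eq_single (y 0), Finset.sum_congr rfl fun d _ =>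
      Fintype.sum_eq_single (y (Fin.last (n + 1))) ?_]
    · simp only [h, and_self, if_true]
      split_ifs <;> rw [Matrix.mul_apply]
    · intro w hw; simp [hw]
    · intro b hb; simp [hb]
  · rw [if_neg h]
    refine Finset.sum_eq_zero fun b _ => Finset.sum_eq_zero fun d _ =>
      Finset.sum_eq_zero fun w _ => ?_
    by_cases h' : x 0 = b ∧ x (Fin.last (n + 1)) = w
    · obtain ⟨rfl, rfl⟩ := h'
      simp [h]
    · rw [if_neg h', zero_mul]

theorem conjTranspose_blockOp (A₀ A₁ : Op n) : (blockOp A₀ A₁)ᴴ = blockOp A₀ᴴ A₁ᴴ := by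
  ext x y
  simp only [Matrix.conjTranspose_apply, blockOp, Matrix.of_apply]
  by_cases h : x 0 = y 0 ∧ x (Fin.last (n + 1)) = y (Fin.last (n + 1))
  · rw [if_pos h, if_pos ⟨h.1.symm, h.2.symm⟩, h.1]
    split_ifs <;> rfl
  · rw [if_neg h, if_neg fun h' => h ⟨h'.1.symm, h'.2.symm⟩, star_zero]

theorem dataPart_update_zero (s : Basis (n + 2)) (b : Fin 2) :
    dataPart (Function.update s 0 b) = dataPart s := by
  ext i; simp [dataPart]

theorem last_update_zero (s : Basis (n + 2)) (b : Fin 2) :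
    Function.update s 0 b (Fin.last (n + 1)) = s (Fin.last (n + 1)) :=
  Function.update_of_ne (Fin.last_pos.ne') _ _

/-- Allows the first Hadamard gate of the test to be moved behind `V`, next to the controlled
operation whose sign it absorbs. -/
theorem onData_mul_onQubit_zero (V : Op n) (M : Matrix (Fin 2) (Fin 2) ℂ) :
    onData V * onQubit 0 M = onQubit 0 M * onData V := by
  ext x y
  rw [mul_onQubit_apply, onQubit_mul_apply]
  simp only [onData, Matrix.of_apply, dataPart_update_zero, last_update_zero,
    Function.update_self]
  by_cases h : x (Fin.last (n + 1)) = y (Fin.last (n + 1))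
  · simp [h, mul_comm]
  · simp [h]

/-- The outcome probabilities of a Hadamard test. -/
theorem estimates_hadamardTest (A₀ A₁ : Op n) :
    Estimates (onQubit 0 hadamard * blockOp A₀ A₁ * onQubit 0 hadamard) ((A₀ᴴ * A₁) 0 0) := by
  have h2 : ((1 / Real.sqrt 2 : ℝ) : ℂ) * ((1 / Real.sqrt 2 : ℝ) : ℂ) = 1 / 2 := by
    rw [← Complex.ofReal_mul, div_mul_div_comm, Real.mul_self_sqrt (by norm_num)]
    push_cast; norm_num
  -- The final amplitudes are `(A₀ ± A₁) / 2` applied to `|0⟩`. The difference of the squared norms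
  -- is then the real part of the inner product of the two branches, summand by summand in `d`.
  have amp : ∀ (b : Fin 2) (d : Basis n) (w : Fin 2),
      (onQubit 0 hadamard * blockOp A₀ A₁ * onQubit 0 hadamard : Op (n + 2)) (mk b d w) 0 =
        if w = 0 then (1 / 2) * (A₀ d 0 + (if b = 0 then 1 else -1) * A₁ d 0) else 0 := by
    intro b d w
    have h0 : dataPart (0 : Basis (n + 2)) = 0 := rfl
    rw [mul_onQubit_apply]
    simp only [onQubit_mul_apply]
    simp only [Fin.sum_univ_two, blockOp, Matrix.of_apply, dataPart_update_zero, last_update_zero,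
      Function.update_self, mk_zero, mk_last, dataPart_mk, h0, Pi.zero_apply, hadamard,
      Matrix.smul_apply, smul_eq_mul]
    by_cases hw : w = 0
    · subst hw
      rw [← h2]
      fin_cases b <;> simp <;> ring
    · simp [hw]
  unfold Estimates outcomeProb
  simp only [Matrix.mulVec_single_one, Matrix.col_apply]
  rw [sum_basis, sum_basis, Matrix.mul_apply, Complex.re_sum]
  simp only [Fin.sum_univ_two, mk_zero, amp]
  simp only [Matrix.conjTranspose_apply]
  rw [← Finset.sum_add_distrib, ← Finset.sum_add_distrib, ← Finset.sum_sub_distrib]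
  refine Finset.sum_congr rfl fun d _ => ?_
  simp only [← Complex.normSq_eq_norm_sq]
  simp [Complex.normSq_apply]
  ring

/-! ### Matrices with real entries -/

theorem IsReal.mul {A B : Op n} (hA : IsReal A) (hB : IsReal B) : IsReal (A * B) := by
  intro x y
  rw [Matrix.mul_apply, Complex.im_sum]
  exact Finset.sum_eq_zero fun z _ => by simp [hA x z, hB z y]

theorem IsReal.conjTranspose {A : Op n} (hA : IsReal A) : IsReal Aᴴ := by
  intro x y
  simp [Matrix.conjTranspose_apply, hA y x]

/-! ### Binary expansions -/

theorem val_eq_finFunctionFinEquiv {k : ℕ} (x : Basis k) :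
    val x = finFunctionFinEquiv (fun i => x i.rev) := by
  rw [finFunctionFinEquiv_apply, val, ← Equiv.sum_comp Fin.revPerm]
  refine Finset.sum_congr rfl fun i _ => ?_
  have := i.isLt
  rw [Fin.revPerm_apply, Fin.val_rev]
  congr 2
  omega

/-- Basis states correspond to the numbers less than `2 ^ k`. -/
def valEquiv (k : ℕ) : Basis k ≃ Fin (2 ^ k) :=
  (Equiv.arrowCongr Fin.revPerm (Equiv.refl _)).trans finFunctionFinEquiv

theorem val_valEquiv {k : ℕ} (x : Basis k) : (valEquiv k x : ℕ) = val x := by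
  rw [val_eq_finFunctionFinEquiv]; rfl

theorem val_lt {k : ℕ} (x : Basis k) : val x < 2 ^ k := by
  rw [← val_valEquiv]; exact (valEquiv k x).isLt

theorem val_inj {k : ℕ} {x y : Basis k} : val x = val y ↔ x = y := by
  rw [← val_valEquiv, ← val_valEquiv, Fin.val_inj, (valEquiv k).injective.eq_iff]

/-- The qubits of the data register, the least significant one first. -/
def dataList (n : ℕ) : List (Fin (n + 2)) := List.ofFn fun i : Fin n => dataQubit i.rev

@[simp] theorem length_dataList : (dataList n).length = n := List.length_ofFn

theorem mem_dataList {q : Fin (n + 2)} : q ∈ dataList n ↔ ∃ i, dataQubit i = q := by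
  rw [dataList, List.mem_ofFn]
  exact ⟨fun ⟨i, h⟩ => ⟨i.rev, h⟩, fun ⟨i, h⟩ => ⟨i.rev, by rw [Fin.rev_rev, h]⟩⟩

@[simp] theorem dataQubit_mem_dataList (i : Fin n) : dataQubit i ∈ dataList n :=
  mem_dataList.2 ⟨i, rfl⟩

@[simp] theorem zero_notMem_dataList : (0 : Fin (n + 2)) ∉ dataList n := fun h =>
  let ⟨i, hi⟩ := mem_dataList.1 h; dataQubit_ne_zero i hi

@[simp] theorem last_notMem_dataList : Fin.last (n + 1) ∉ dataList n := fun h =>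
  let ⟨i, hi⟩ := mem_dataList.1 h; dataQubit_ne_last i hi

theorem nodup_dataList : (0 :: Fin.last (n + 1) :: dataList n).Nodup := by
  simp only [List.nodup_cons, List.mem_cons, not_or]
  refine ⟨⟨Fin.last_pos.ne, zero_notMem_dataList⟩, last_notMem_dataList, ?_⟩
  exact List.nodup_ofFn.2 (dataQubit_injective.comp Fin.rev_injective)

theorem nodup_zero_dataList : ((0 : Fin (n + 2)) :: dataList n).Nodup :=
  List.nodup_cons.2 ⟨zero_notMem_dataList,
    (List.nodup_cons.1 (List.nodup_cons.1 nodup_dataList).2).2⟩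

theorem lval_ofFn {k : ℕ} (s : Basis (n + 2)) (g : Fin k → Fin (n + 2)) :
    lval s (List.ofFn g) = ∑ i, (s (g i) : ℕ) * 2 ^ (i : ℕ) := by
  induction k with
  | zero => simp [lval]
  | succ k ih =>
    rw [List.ofFn_succ, lval, ih, Fin.sum_univ_succ, Finset.mul_sum]
    simp only [Fin.val_zero, pow_zero, mul_one, Fin.val_succ, pow_succ]
    congr 1
    exact Finset.sum_congr rfl fun i _ => by ring

theorem lval_dataList (s : Basis (n + 2)) : lval s (dataList n) = val (dataPart s) := by
  rw [dataList, lval_ofFn, val_eq_finFunctionFinEquiv, finFunctionFinEquiv_apply]; rfl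

theorem val_flipAll (y : Basis n) : val (fun i => y i + 1) + val y + 1 = 2 ^ n := by
  have := lval_of_forall_add_one (s := mk 0 y 0) (s' := mk 0 (fun i => y i + 1) 0)
    (l := dataList n) fun q hq => by
      obtain ⟨i, rfl⟩ := mem_dataList.1 hq
      have h₁ := congrFun (dataPart_mk 0 y 0) i
      have h₂ := congrFun (dataPart_mk 0 (fun i => y i + 1) 0) i
      exact h₂.trans (by rw [← h₁]; rfl)
  simpa [lval_dataList] using this

/-! ### Signed permutations -/

/-- The operator `|y⟩ ↦ (-1) ^ f y |π y⟩`. -/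
noncomputable def signedPerm (π : Equiv.Perm (Basis n)) (f : Basis n → Fin 2) : Op n :=
  Matrix.of fun x y => if x = π y then (-1) ^ (f y : ℕ) else 0

theorem signedPerm_apply (π : Equiv.Perm (Basis n)) (f : Basis n → Fin 2) (x y : Basis n) :
    signedPerm π f x y = if x = π y then (-1) ^ (f y : ℕ) else 0 := rfl

theorem neg_one_pow_fin_add (a b : Fin 2) :
    (-1 : ℂ) ^ ((a + b : Fin 2) : ℕ) = (-1) ^ (a : ℕ) * (-1) ^ (b : ℕ) := by
  fin_cases a <;> fin_cases b <;> simp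

theorem signedPerm_mul (π π' : Equiv.Perm (Basis n)) (f f' : Basis n → Fin 2) :
    signedPerm π f * signedPerm π' f' = signedPerm (π * π') fun y => f (π' y) + f' y := by
  ext x y
  simp [Matrix.mul_apply, signedPerm_apply, neg_one_pow_fin_add]

theorem signedPerm_mem_unitaryGroup (π : Equiv.Perm (Basis n)) (f : Basis n → Fin 2) :
    signedPerm π f ∈ Matrix.unitaryGroup (Basis n) ℂ := by
  rw [Matrix.mem_unitaryGroup_iff']
  ext x y
  have sq : ∀ a : Fin 2, (-1 : ℂ) ^ (a : ℕ) * (-1) ^ (a : ℕ) = 1 := by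
    intro a; fin_cases a <;> simp
  rw [Matrix.mul_apply, Matrix.one_apply]
  simp only [Matrix.star_apply, signedPerm_apply, mul_ite, mul_zero, Finset.sum_ite_eq',
    Finset.mem_univ, if_true]
  by_cases h : x = y
  · subst h; simp [sq]
  · have : ¬ y = x := fun e => h e.symm
    simp [h, this]

theorem isReal_signedPerm (π : Equiv.Perm (Basis n)) (f : Basis n → Fin 2) :
    IsReal (signedPerm π f) := by
  intro x y
  have : ∀ a : Fin 2, ((-1 : ℂ) ^ (a : ℕ)).im = 0 := by intro a; fin_cases a <;> simp
  rw [signedPerm_apply]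
  split_ifs
  · exact this _
  · rfl

theorem signedPerm_one_zero : signedPerm (1 : Equiv.Perm (Basis n)) (fun _ => 0) = 1 := by
  ext x y; simp [signedPerm_apply, Matrix.one_apply]

theorem conjTranspose_signedPerm_zero (π : Equiv.Perm (Basis n)) :
    (signedPerm π fun _ => 0)ᴴ = signedPerm π.symm fun _ => 0 := by
  ext x y
  have : y = π x ↔ x = π.symm y := by rw [Equiv.eq_symm_apply, eq_comm]
  simp only [Matrix.conjTranspose_apply, signedPerm_apply, this]
  split_ifs <;> simp

/-- The increment. -/
def incrPerm (n : ℕ) : Equiv.Perm (Basis n) :=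
  (valEquiv n).trans ((Equiv.addRight 1).trans (valEquiv n).symm)

theorem val_incrPerm (y : Basis n) : val (incrPerm n y) = (val y + 1) % 2 ^ n := by
  rw [← val_valEquiv, ← val_valEquiv, incrPerm]
  simp [Fin.val_add]

/-- Negation of the bit `q`. -/
def flipPerm (q : Fin n) : Equiv.Perm (Basis n) :=
  Function.Involutive.toPerm (fun y => Function.update y q (y q + 1)) fun y => by
    have key : ∀ a : Fin 2, a + 1 + 1 = a := by decide
    simp [key]

theorem flipPerm_apply (q : Fin n) (y : Basis n) :
    flipPerm q y = Function.update y q (y q + 1) := rfl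

/-- Negation of all bits. -/
def flipAllPerm (n : ℕ) : Equiv.Perm (Basis n) :=
  Function.Involutive.toPerm (fun y i => y i + 1) fun y => by
    have key : ∀ a : Fin 2, a + 1 + 1 = a := by decide
    simp [key]

theorem flipAllPerm_apply (y : Basis n) : flipAllPerm n y = fun i => y i + 1 := rfl

theorem flipAllPerm_mul_self : flipAllPerm n * flipAllPerm n = 1 := by
  have key : ∀ a : Fin 2, a + 1 + 1 = a := by decide
  ext y i; simp [flipAllPerm_apply, key]

/-- Whether the basis state is the first one or the last one. -/
def corner (y : Basis n) : Fin 2 := if val y = 0 ∨ val y + 1 = 2 ^ n then 1 else 0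

theorem eq_flipAllPerm_iff {x y : Basis n} : x = flipAllPerm n y ↔ val x + val y + 1 = 2 ^ n := by
  have := val_flipAll y
  rw [← val_inj, flipAllPerm_apply]; omega

theorem incr_eq_signedPerm : incr n = signedPerm (incrPerm n) fun _ => 0 := by
  ext x y
  simp [incr, signedPerm_apply, ← val_incrPerm, val_inj]

theorem pauliX_apply (a b : Fin 2) : pauliX a b = if a = b + 1 then 1 else 0 := by
  fin_cases a <;> fin_cases b <;> simp [pauliX]

theorem xAll_eq_signedPerm : xAll n = signedPerm (flipAllPerm n) fun _ => 0 := by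
  ext x y
  rw [xAll, tensor_apply, signedPerm_apply, flipAllPerm_apply]
  simp only [pauliX_apply, Finset.prod_ite_zero, Finset.mem_univ, true_imp_iff, funext_iff]
  simp

theorem cMinus_eq_signedPerm :
    cMinus n = signedPerm (flipAllPerm n) fun y => corner y + 1 := by
  ext x y
  simp only [cMinus, Matrix.of_apply, signedPerm_apply, eq_flipAllPerm_iff]
  split_ifs with h₁ h₂
  · rw [corner, if_pos (by omega)]; simp
  · rw [corner, if_neg (by omega)]; simp
  · rfl

theorem neg_cMinus_eq_signedPerm : -cMinus n = signedPerm (flipAllPerm n) corner := by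
  rw [cMinus_eq_signedPerm]
  ext x y
  simp only [Matrix.neg_apply, signedPerm_apply, neg_one_pow_fin_add]
  split_ifs <;> simp

theorem onQubit_pauliX_eq_signedPerm (q : Fin n) :
    onQubit q pauliX = signedPerm (flipPerm q) fun _ => 0 := by
  ext x y
  rw [onQubit_apply, pauliX_apply, signedPerm_apply, ← ite_and, flipPerm_apply]
  simp only [Fin.val_zero, pow_zero]
  congr 1
  rw [eq_iff_iff]
  constructor
  · rintro ⟨h₁, h₂⟩
    ext i
    by_cases hi : i = q
    · subst hi; simp [h₂]
    · simp [hi, h₁ i hi]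
  · rintro rfl
    exact ⟨fun i hi => by simp [hi], by simp⟩

theorem onQubit_pauliZ_eq_signedPerm (q : Fin n) :
    onQubit q pauliZ = signedPerm 1 fun y => y q := by
  ext x y
  have hZ : ∀ a b : Fin 2, pauliZ a b = if a = b then (-1) ^ (b : ℕ) else 0 := by
    intro a b; fin_cases a <;> fin_cases b <;> simp [pauliZ]
  rw [onQubit_apply, hZ, signedPerm_apply, ← ite_and, Equiv.Perm.one_apply]
  congr 1
  rw [eq_iff_iff, funext_iff]
  refine ⟨fun h i => ?_, fun h => ⟨fun i _ => h i, h q⟩⟩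
  by_cases hi : i = q
  · rw [hi, h.2]
  · exact h.1 i hi

theorem onLast_eq_onQubit (hn : 0 < n) (M : Matrix (Fin 2) (Fin 2) ℂ) :
    onLast n M = onQubit ⟨n - 1, Nat.sub_lt hn one_pos⟩ M := by
  unfold onLast onQubit
  congr 1
  ext1 i
  congr 1
  rw [Fin.ext_iff, eq_iff_iff]
  have := i.isLt
  dsimp only
  omega

/-! ### Controlled operations -/

/-- The circuit applies `π` to the data register if qubit `0` is `1`. -/
def IsControlled (P : List (Gate n)) (π : Equiv.Perm (Basis n)) : Prop :=
  ∀ s, run P s 0 = s 0 ∧ dataPart (run P s) = (if s 0 = 1 then π (dataPart s) else dataPart s) ∧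
    run P s (Fin.last (n + 1)) = s (Fin.last (n + 1))

/-- The circuit adds `f` of the data register to qubit `0`. -/
def IsOracle (M : List (Gate n)) (f : Basis n → Fin 2) : Prop :=
  ∀ s, run M s = Function.update s 0 (s 0 + f (dataPart s))

theorem isControlled_nil : IsControlled ([] : List (Gate n)) 1 := fun s => by simp

theorem IsControlled.reverse {P : List (Gate n)} {π : Equiv.Perm (Basis n)}
    (h : IsControlled P π) : IsControlled P.reverse π.symm := fun s => by
  obtain ⟨h₁, h₂, h₃⟩ := h (run P.reverse s)
  rw [run_run_reverse] at h₁ h₂ h₃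
  refine ⟨h₁.symm, ?_, h₃.symm⟩
  rw [h₂, ← h₁]
  split_ifs <;> simp

theorem isControlled_cn (q : Fin n) : IsControlled (cn 0 (dataQubit q)) (flipPerm q) := fun s => by
  have hq := dataQubit_ne_zero q
  have hl := dataQubit_ne_last q
  have bit : ∀ b : Fin 2, b = 0 ∨ b = 1 := by decide
  rw [run_cn hq.symm]
  refine ⟨Function.update_of_ne hq.symm _ _, ?_, Function.update_of_ne hl.symm _ _⟩
  rcases bit (s 0) with h | h
  · rw [h, add_zero, Function.update_eq_self]; rfl
  · rw [h, if_pos rfl, flipPerm_apply]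
    ext i
    by_cases hi : i = q
    · subst hi; simp [dataPart]
    · simp [dataPart, hi, dataQubit_injective.ne hi]

theorem isControlled_flipIf : IsControlled (flipIf 0 (dataList n)) (flipAllPerm n) := fun s => by
  have bit : ∀ b : Fin 2, b = 0 ∨ b = 1 := by decide
  have h := run_flipIf nodup_zero_dataList s
  refine ⟨by rw [h, if_neg zero_notMem_dataList], ?_, by rw [h, if_neg last_notMem_dataList]⟩
  ext1 i
  rw [dataPart, h, if_pos (dataQubit_mem_dataList i)]
  rcases bit (s 0) with h | h
  · simp [h, dataPart]
  · simp [h, dataPart, flipAllPerm_apply]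

theorem exists_isControlled_incrPerm :
    ∃ P : List (Gate n), ClassicalWithin P (28 * n + 8) ∧ IsControlled P (incrPerm n) := by
  obtain ⟨P, hP, hs⟩ := exists_increment (nodup_dataList (n := n))
  rw [length_dataList] at hP
  refine ⟨P, hP, fun s => ?_⟩
  obtain ⟨h₁, h₂⟩ := hs s
  refine ⟨h₁ _ zero_notMem_dataList, ?_, h₁ _ last_notMem_dataList⟩
  unfold Incremented at h₂
  rw [lval_dataList, lval_dataList, length_dataList] at h₂
  have h₃ : (val (dataPart (run P s)) + 2 ^ n * _) % 2 ^ n = _ % 2 ^ n := congrArg (· % 2 ^ n) h₂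
  rw [Nat.add_mul_mod_self_left, Nat.mod_eq_of_lt (val_lt _)] at h₃
  have bit : ∀ b : Fin 2, b = 0 ∨ b = 1 := by decide
  rcases bit (s 0) with h | h
  · rw [h, if_neg (by decide), ← val_inj, h₃, h, Fin.val_zero, add_zero,
      Nat.mod_eq_of_lt (val_lt _)]
  · rw [h, if_pos rfl, ← val_inj, h₃, h, Fin.val_one, val_incrPerm]

theorem isOracle_nil : IsOracle ([] : List (Gate n)) fun _ => 0 := fun s => by simp

theorem IsOracle.append {M M' : List (Gate n)} {f f' : Basis n → Fin 2} (h : IsOracle M f)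
    (h' : IsOracle M' f') : IsOracle (M ++ M') fun y => f y + f' y := fun s => by
  rw [run_append, h, h', Function.update_self, Function.update_idem, dataPart_update_zero,
    add_assoc]

theorem isOracle_x : IsOracle ([.x 0] : List (Gate n)) fun _ => 1 := fun _ => rfl

theorem isOracle_cn (q : Fin n) : IsOracle (cn (dataQubit q) 0) fun y => y q := fun s => by
  rw [run_cn (dataQubit_ne_zero q)]; rfl

/-- Needed for the last Robin term, where the sign is evaluated after the last bit has been negated.
-/
theorem IsOracle.comp_flipPerm {M : List (Gate n)} {f : Basis n → Fin 2} (h : IsOracle M f)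
    (q : Fin n) :
    IsOracle ([.x (dataQubit q)] ++ M ++ [.x (dataQubit q)]) fun y => f (flipPerm q y) :=
  fun s => by
    have key : ∀ a : Fin 2, a + 1 + 1 = a := by decide
    have hq := dataQubit_ne_zero q
    have e : dataPart (Function.update s (dataQubit q) (s (dataQubit q) + 1)) =
        flipPerm q (dataPart s) := by
      ext i
      by_cases hi : i = q
      · subst hi; simp [dataPart, flipPerm_apply]
      · simp [dataPart, flipPerm_apply, hi, dataQubit_injective.ne hi]
    rw [run_append, run_append, run_x, h, run_x, e, Function.update_of_ne hq,
      Function.update_of_ne hq.symm, Function.update_self, key, Function.update_comm hq]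
    simp

theorem conj_dataList (s : Basis (n + 2)) :
    conj s (dataList n) = 1 ↔ val (dataPart s) + 1 = 2 ^ n := by
  rw [← lval_add_one_eq_iff, lval_dataList, length_dataList]

/-- A multicontrolled NOT detects the state of all ones; conjugated by the negation of all data
qubits, it detects the zero state. -/
theorem exists_isOracle_corner (hn : 0 < n) :
    ∃ M : List (Gate n), ClassicalWithin M (18 * n + 8) ∧ IsOracle M corner := by
  have hne : dataList n ≠ [] := fun h => by
    have := length_dataList (n := n); rw [h] at this; simp at this; omega
  obtain ⟨C, hC, hs⟩ := exists_mcx hne nodup_dataList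
  have hF := classicalWithin_flipList (dataList n)
  rw [length_dataList] at hC hF
  refine ⟨(C ++ flipList (dataList n)) ++ (C ++ flipList (dataList n)),
    ((hC.append hF).append (hC.append hF)).mono (by omega), fun s => ?_⟩
  have key : ∀ a : Fin 2, a + 1 + 1 = a := by decide
  have bit : ∀ b : Fin 2, b ≠ 1 → b = 0 := by decide
  have hnd := (List.nodup_cons.1 (List.nodup_cons.1 (nodup_dataList (n := n))).2).2
  rw [run_append, run_append, run_append, hs, hs]
  obtain ⟨s', hs'⟩ : ∃ s', s' = run (flipList (dataList n))
      (Function.update s 0 (s 0 + conj s (dataList n))) := ⟨_, rfl⟩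
  rw [← hs']
  have hs'0 : s' 0 = s 0 + conj s (dataList n) := by
    rw [hs', run_flipList hnd, if_neg zero_notMem_dataList, Function.update_self]
  have hs'd : dataPart s' = flipAllPerm n (dataPart s) := by
    ext1 i
    rw [dataPart, hs', run_flipList hnd, if_pos (dataQubit_mem_dataList i),
      Function.update_of_ne (dataQubit_ne_zero i)]
    rfl
  have hc : conj s (dataList n) + conj s' (dataList n) = corner (dataPart s) := by
    have h₁ := conj_dataList s
    have h₂ := conj_dataList s'
    have h₃ := val_flipAll (dataPart s)
    -- The two corner states are distinct because `n ≥ 1`; otherwise the two indicators would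
    -- cancel.
    have h₄ : 2 ≤ 2 ^ n := by
      calc 2 = 2 ^ 1 := rfl
        _ ≤ 2 ^ n := Nat.pow_le_pow_right (by norm_num) hn
    rw [hs'd, flipAllPerm_apply] at h₂
    by_cases c₁ : val (dataPart s) + 1 = 2 ^ n
    · rw [h₁.2 c₁, bit (conj s' _) (fun h => by have := h₂.1 h; omega), corner, if_pos (Or.inr c₁)]; rfl
    · rw [bit (conj s _) (fun h => c₁ (h₁.1 h))]
      by_cases c₂ : val (dataPart s) = 0
      · rw [h₂.2 (by omega), corner, if_pos (Or.inl c₂)]; rfl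
      · rw [bit (conj s' _) (fun h => by have := h₂.1 h; omega), corner, if_neg (by omega)]; rfl
  rw [basis_ext_iff]
  refine ⟨?_, ?_, ?_⟩
  · rw [run_flipList hnd, if_neg zero_notMem_dataList, Function.update_self, Function.update_self,
      hs'0, add_assoc, hc]
  · rw [dataPart_update_zero]
    ext1 i
    rw [dataPart, run_flipList hnd, if_pos (dataQubit_mem_dataList i),
      Function.update_of_ne (dataQubit_ne_zero i)]
    have := congrFun hs'd i
    rw [dataPart, flipAllPerm_apply] at this
    rw [this, key]
  · rw [run_flipList hnd, if_neg last_notMem_dataList, last_update_zero, last_update_zero, hs',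
      run_flipList hnd, if_neg last_notMem_dataList, last_update_zero]

/-! ### The terms of the decompositions, and phase kickback -/

/-- The operator is a signed permutation that can be implemented, under the control of qubit `0`,
with at most `B` classical gates for the permutation and for the sign. -/
def Implementable (R : Op n) (B : ℕ) : Prop :=
  ∃ π f P M, R = signedPerm π f ∧ ClassicalWithin P B ∧ ClassicalWithin M B ∧
    IsControlled P π ∧ IsOracle M f

/-- The most expensive ingredient is the increment, with `28 n + 8 ≤ 36 n` gates. In `xAll n *
cMinus n` the two reversals of the basis cancel, so only a diagonal sign remains. -/
theorem implementable_lcuTerm (hn : 1 ≤ n) (α : Boundary) (l : Fin (numTerms α)) :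
    Implementable (lcuTerm n α l) (40 * n) := by
  obtain ⟨I, hI, hI'⟩ := exists_isControlled_incrPerm (n := n)
  obtain ⟨C, hC, hC'⟩ := exists_isOracle_corner hn
  have hF := classicalWithin_flipIf (0 : Fin (n + 2)) (dataList n)
  rw [length_dataList] at hF
  have i_one : Implementable (1 : Op n) (40 * n) :=
    ⟨1, _, [], [], signedPerm_one_zero.symm, classicalWithin_nil _, classicalWithin_nil _,
      isControlled_nil, isOracle_nil⟩
  have i_incr : Implementable (incr n) (40 * n) :=
    ⟨_, _, I, [], incr_eq_signedPerm, hI.mono (by omega), classicalWithin_nil _, hI',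
      isOracle_nil⟩
  have i_incr' : Implementable (incr n)ᴴ (40 * n) :=
    ⟨_, _, I.reverse, [], by rw [incr_eq_signedPerm, conjTranspose_signedPerm_zero],
      hI.reverse.mono (by omega), classicalWithin_nil _, hI'.reverse, isOracle_nil⟩
  have i_xAll : Implementable (xAll n) (40 * n) :=
    ⟨_, _, _, [], xAll_eq_signedPerm, hF.mono (by omega), classicalWithin_nil _,
      isControlled_flipIf, isOracle_nil⟩
  have i_negC : Implementable (-cMinus n) (40 * n) :=
    ⟨_, _, _, C, neg_cMinus_eq_signedPerm, hF.mono (by omega), hC.mono (by omega),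
      isControlled_flipIf, hC'⟩
  have hCx := hC.append (classicalWithin_x (0 : Fin (n + 2)))
  have i_C : Implementable (cMinus n) (40 * n) :=
    ⟨_, _, _, _, cMinus_eq_signedPerm, hF.mono (by omega), hCx.mono (by omega),
      isControlled_flipIf, hC'.append isOracle_x⟩
  have eXC : xAll n * cMinus n = signedPerm 1 fun y => corner y + 1 := by
    rw [xAll_eq_signedPerm, cMinus_eq_signedPerm, signedPerm_mul, flipAllPerm_mul_self]
    simp only [zero_add]
  have i_XC : Implementable (xAll n * cMinus n) (40 * n) :=
    ⟨_, _, [], _, eXC, classicalWithin_nil _, hCx.mono (by omega), isControlled_nil,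
      hC'.append isOracle_x⟩
  have i_X : Implementable (onLast n pauliX) (40 * n) :=
    ⟨_, _, _, [], by rw [onLast_eq_onQubit hn, onQubit_pauliX_eq_signedPerm],
      (classicalWithin_cn _ _).mono (by omega), classicalWithin_nil _, isControlled_cn _,
      isOracle_nil⟩
  have i_Z : Implementable (onLast n pauliZ) (40 * n) :=
    ⟨_, _, [], _, by rw [onLast_eq_onQubit hn, onQubit_pauliZ_eq_signedPerm],
      classicalWithin_nil _, (classicalWithin_cn _ _).mono (by omega), isControlled_nil,
      isOracle_cn _⟩
  have eXCZ : xAll n * cMinus n * onLast n pauliZ =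
      signedPerm 1 fun y => corner y + 1 + y ⟨n - 1, Nat.sub_lt hn one_pos⟩ := by
    rw [eXC, onLast_eq_onQubit hn, onQubit_pauliZ_eq_signedPerm, signedPerm_mul, mul_one]
    simp only [Equiv.Perm.one_apply]
  have i_XCZ : Implementable (xAll n * cMinus n * onLast n pauliZ) (40 * n) :=
    ⟨_, _, [], _, eXCZ,
      classicalWithin_nil _, (hCx.append (classicalWithin_cn _ _)).mono (by omega),
      isControlled_nil, (hC'.append isOracle_x).append (isOracle_cn _)⟩
  have eXCX : xAll n * cMinus n * onLast n pauliX =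
      signedPerm (flipPerm ⟨n - 1, Nat.sub_lt hn one_pos⟩) fun y =>
        corner (flipPerm ⟨n - 1, Nat.sub_lt hn one_pos⟩ y) + 1 := by
    rw [eXC, onLast_eq_onQubit hn, onQubit_pauliX_eq_signedPerm, signedPerm_mul, one_mul]
    simp only [add_zero]
  have i_XCX : Implementable (xAll n * cMinus n * onLast n pauliX) (40 * n) :=
    ⟨_, _, _, _, eXCX, (classicalWithin_cn _ _).mono (by omega),
      (((classicalWithin_x _).append hCx).append (classicalWithin_x _)).mono (by omega),
      isControlled_cn _, (hC'.append isOracle_x).comp_flipPerm _⟩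
  cases α
  · fin_cases l
    exacts [i_one, i_incr, i_incr', i_xAll, i_negC]
  · fin_cases l
    exacts [i_one, i_incr, i_incr']
  · fin_cases l
    exacts [i_one, i_X, i_xAll, i_Z, i_incr, i_incr', i_C, i_XC, i_XCZ, i_XCX]

/-- Between Hadamard gates, the sign of a controlled signed permutation becomes an oracle. -/
theorem ctrlData_mul_hadamard {π : Equiv.Perm (Basis n)} {f : Basis n → Fin 2}
    {P M : List (Gate n)} (hP : IsControlled P π) (hM : IsOracle M f) :
    ctrlData (signedPerm π f) * onQubit 0 hadamard =
      mapOp (run P) * onQubit 0 hadamard * mapOp (run M) := by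
  have h₁ : ctrlData (signedPerm π f) = mapOp (run P) *
      Matrix.diagonal fun y => if y 0 = 1 then (-1) ^ (f (dataPart y) : ℕ) else 1 := by
    ext x y
    rw [Matrix.mul_diagonal, mapOp_apply]
    obtain ⟨e₁, e₂, e₃⟩ := hP y
    have : x = run P y ↔ x 0 = y 0 ∧ dataPart x =
        (if y 0 = 1 then π (dataPart y) else dataPart y) ∧
        x (Fin.last (n + 1)) = y (Fin.last (n + 1)) := by
      rw [basis_ext_iff, e₁, e₂, e₃]
    simp only [this, ctrlData, Matrix.of_apply]
    by_cases h : x 0 = y 0 ∧ x (Fin.last (n + 1)) = y (Fin.last (n + 1))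
    · rw [if_pos h]
      by_cases hy : y 0 = 1
      · simp [hy, h, signedPerm_apply]
      · simp [hy, h, Matrix.one_apply]
    · rw [if_neg h, if_neg (fun h' => h ⟨h'.1, h'.2.2⟩), zero_mul]
  -- This is `Z^c H = H X^c` on qubit `0`, with `c` the value of `f` on the data register.
  have h₂ : (Matrix.diagonal fun y => if y 0 = 1 then (-1) ^ (f (dataPart y) : ℕ) else 1) *
      onQubit 0 hadamard = onQubit 0 hadamard * mapOp (run M) := by
    ext x y
    rw [Matrix.diagonal_mul, mul_mapOp_apply, hM, onQubit_apply, onQubit_apply,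
      Function.update_self]
    have : (∀ i, i ≠ 0 → x i = Function.update y 0 (y 0 + f (dataPart y)) i) ↔
        ∀ i, i ≠ 0 → x i = y i :=
      forall_congr' fun i => forall_congr' fun hi => by rw [Function.update_of_ne hi]
    simp only [this]
    by_cases h : ∀ i, i ≠ 0 → x i = y i
    · rw [if_pos h, if_pos h]
      have hd : dataPart x = dataPart y := funext fun i => h _ (dataQubit_ne_zero i)
      have key : ∀ a b c : Fin 2, (if a = 1 then (-1 : ℂ) ^ (c : ℕ) else 1) * hadamard a b =
          hadamard a (b + c) := by
        intro a b c
        fin_cases a <;> fin_cases b <;> fin_cases c <;> simp [hadamard]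
      rw [hd, key]
    · rw [if_neg h, if_neg h, mul_zero]
  rw [h₁, mul_assoc, h₂, mul_assoc]

/-! ### The decompositions of the Laplacians -/

theorem one_apply_val (x y : Basis n) : (1 : Op n) x y = if val x = val y then 1 else 0 := by
  rw [Matrix.one_apply]; simp only [val_inj]

theorem xAll_apply_val (x y : Basis n) :
    xAll n x y = if val x + val y + 1 = 2 ^ n then 1 else 0 := by
  rw [xAll_eq_signedPerm, signedPerm_apply]
  simp only [eq_flipAllPerm_iff, Fin.val_zero, pow_zero]

theorem incr_apply_val (x y : Basis n) :
    incr n x y = if val x = (val y + 1) % 2 ^ n then 1 else 0 := rfl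

theorem conjTranspose_incr_apply_val (x y : Basis n) :
    (incr n)ᴴ x y = if val y = (val x + 1) % 2 ^ n then 1 else 0 := by
  rw [Matrix.conjTranspose_apply, incr_apply_val]; split_ifs <;> simp

theorem cMinus_apply_val (x y : Basis n) :
    cMinus n x y = if val x + val y + 1 = 2 ^ n then
      (if val x = 0 ∨ val y = 0 then 1 else -1) else 0 := rfl

/-- Hence half the sum of this operator and the identity is the projection onto the first and the
last basis state. It restricts the Robin corrections to the boundary rows. -/
theorem xAll_mul_cMinus :
    xAll n * cMinus n =
      Matrix.diagonal fun x => if val x = 0 ∨ val x + 1 = 2 ^ n then 1 else -1 := by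
  rw [xAll_eq_signedPerm, cMinus_eq_signedPerm, signedPerm_mul, flipAllPerm_mul_self]
  ext x y
  rw [signedPerm_apply, Matrix.diagonal_apply, Equiv.Perm.one_apply]
  by_cases h : x = y
  · subst h
    rw [if_pos rfl, if_pos rfl, corner]
    split_ifs <;> simp
  · rw [if_neg h, if_neg h]

/-- The last qubit is the least significant bit, so negating it changes the parity and keeps the
quotient by two. -/
theorem val_eq_add_two_mul (hn : 0 < n) (y : Basis n) :
    ∃ v, val y = y ⟨n - 1, Nat.sub_lt hn one_pos⟩ + 2 * v ∧
      val (flipPerm ⟨n - 1, Nat.sub_lt hn one_pos⟩ y) =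
        (y ⟨n - 1, Nat.sub_lt hn one_pos⟩ + 1 : Fin 2) + 2 * v := by
  obtain ⟨m, rfl⟩ : ∃ m, n = m + 1 := ⟨n - 1, by omega⟩
  have hl : (⟨m + 1 - 1, Nat.sub_lt hn one_pos⟩ : Fin (m + 1)) = Fin.last m := rfl
  have key : ∀ z : Basis (m + 1), val z = z (Fin.last m) + 2 * val fun i => z i.castSucc := by
    intro z
    rw [val, Fin.sum_univ_castSucc, val, Finset.mul_sum, add_comm]
    congr 1
    · simp
    · refine Finset.sum_congr rfl fun i _ => ?_
      have := i.isLt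
      have e : m + 1 - 1 - (i.castSucc : ℕ) = m - 1 - i + 1 := by
        rw [Fin.val_castSucc]; omega
      rw [e, pow_succ]; ring
  refine ⟨val fun i => y i.castSucc, key y, ?_⟩
  rw [hl, key, flipPerm_apply, Function.update_self]
  congr 3
  ext1 i
  rw [Function.update_of_ne (Fin.castSucc_lt_last i).ne]

theorem onLast_pauliX_apply_val (hn : 0 < n) (x y : Basis n) :
    onLast n pauliX x y =
      if (val x + 1 = val y ∧ val x % 2 = 0) ∨ (val y + 1 = val x ∧ val y % 2 = 0) then 1 else 0 := by
  rw [onLast_eq_onQubit hn, onQubit_pauliX_eq_signedPerm, signedPerm_apply, Fin.val_zero, pow_zero]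
  congr 1
  obtain ⟨v, h₁, h₂⟩ := val_eq_add_two_mul hn y
  rw [← val_inj, eq_iff_iff, h₂]
  have bit : ∀ b : Fin 2, (b : ℕ) = 0 ∧ ((b + 1 : Fin 2) : ℕ) = 1 ∨
      (b : ℕ) = 1 ∧ ((b + 1 : Fin 2) : ℕ) = 0 := by decide
  rcases bit (y ⟨n - 1, Nat.sub_lt hn one_pos⟩) with ⟨b₁, b₂⟩ | ⟨b₁, b₂⟩ <;> omega

theorem onLast_pauliZ_apply_val (hn : 0 < n) (x y : Basis n) :
    onLast n pauliZ x y = if val x = val y then (if val x % 2 = 0 then 1 else -1) else 0 := by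
  rw [onLast_eq_onQubit hn, onQubit_pauliZ_eq_signedPerm, signedPerm_apply, Equiv.Perm.one_apply]
  by_cases h : x = y
  · subst h
    rw [if_pos rfl, if_pos rfl]
    obtain ⟨v, h₁, -⟩ := val_eq_add_two_mul hn x
    have bit : ∀ b : Fin 2, b = 0 ∨ b = 1 := by decide
    rcases bit (x ⟨n - 1, Nat.sub_lt hn one_pos⟩) with b | b <;> rw [b] at h₁ ⊢
    · rw [Fin.val_zero] at h₁
      rw [if_pos (by omega)]; simp
    · rw [Fin.val_one] at h₁
      rw [if_neg (by omega)]; simp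
  · rw [if_neg h, if_neg (val_inj.not.2 h)]

theorem add_one_mod_eq {b N : ℕ} (h : b < N) :
    (b + 1) % N = if b + 1 = N then 0 else b + 1 := by
  split_ifs with h'
  · rw [h', Nat.mod_self]
  · exact Nat.mod_eq_of_lt (by omega)

/-- The two antidiagonal terms cancel each other except in the two corners, where they add up to
`-1` and remove the wrap-around of the increment and its adjoint. -/
theorem laplacian_dirichlet (hn : 1 ≤ n) (a₀ a₁ : ℝ) :
    laplacian n a₀ a₁ .dirichlet =
      ∑ l, ((lcuCoeff n a₀ a₁ .dirichlet l : ℝ) : ℂ) • lcuTerm n .dirichlet l := by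
  obtain ⟨N, hN⟩ : ∃ N, 2 ^ n = 2 * N := ⟨2 ^ (n - 1), by rw [← pow_succ']; congr 1; omega⟩
  change _ = ∑ l : Fin 5, ((![-2, 1, 1, -1 / 2, 1 / 2] l : ℝ) : ℂ) •
    (![1, incr n, (incr n)ᴴ, xAll n, -cMinus n] : Fin 5 → Op n) l
  simp only [Fin.sum_univ_succ, Fin.sum_univ_zero, Matrix.cons_val_zero, Matrix.cons_val_succ]
  ext x y
  have ha := val_lt x
  have hb := val_lt y
  simp only [laplacian, Matrix.of_apply, Matrix.add_apply, Matrix.smul_apply, smul_eq_mul,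
    Matrix.neg_apply, Matrix.zero_apply, one_apply_val, xAll_apply_val, incr_apply_val,
    conjTranspose_incr_apply_val, cMinus_apply_val, add_one_mod_eq ha, add_one_mod_eq hb]
  rw [hN] at ha hb ⊢
  generalize val x = a at *
  generalize val y = b at *
  have ha' : a = 0 ∨ a + 1 = 2 * N ∨ (a ≠ 0 ∧ a + 1 ≠ 2 * N) := by omega
  have hb' : b = 0 ∨ b + 1 = 2 * N ∨ (b ≠ 0 ∧ b + 1 ≠ 2 * N) := by omega
  have hab : a = b ∨ a + 1 = b ∨ b + 1 = a ∨ (a ≠ b ∧ a + 1 ≠ b ∧ b + 1 ≠ a) := by omega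
  have hab' : a + b + 1 = 2 * N ∨ a + b + 1 ≠ 2 * N := by omega
  rcases ha' with ha' | ha' | ha' <;> rcases hb' with hb' | hb' | hb' <;>
    rcases hab with hab | hab | hab | hab <;> rcases hab' with hab' | hab' <;>
    first
      | (exfalso; omega)
      | (simp (disch := omega) only [if_pos, if_neg]; push_cast; ring)

theorem laplacian_periodic (a₀ a₁ : ℝ) :
    laplacian n a₀ a₁ .periodic =
      ∑ l, ((lcuCoeff n a₀ a₁ .periodic l : ℝ) : ℂ) • lcuTerm n .periodic l := by
  change _ = ∑ l : Fin 3, ((![-2, 1, 1] l : ℝ) : ℂ) •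
    (![1, incr n, (incr n)ᴴ] : Fin 3 → Op n) l
  simp only [Fin.sum_univ_succ, Fin.sum_univ_zero, Matrix.cons_val_zero, Matrix.cons_val_succ]
  ext x y
  simp only [laplacian, Matrix.of_apply, Matrix.add_apply, Matrix.smul_apply, smul_eq_mul,
    Matrix.zero_apply, one_apply_val, incr_apply_val, conjTranspose_incr_apply_val]
  split_ifs <;> norm_num

/-- The antidiagonal terms again remove the wrap-around. The terms with `pauliX` raise the
off-diagonal entries of the boundary rows from `1` to `2`. The identity and `pauliZ`, projected to
these rows, contribute `(a₀ - a₁) ± (a₀ + a₁)` times the mesh width, that is `2 a₀` and `-2 a₁`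
times it. -/
theorem laplacian_robin (hn : 1 ≤ n) (a₀ a₁ : ℝ) :
    laplacian n a₀ a₁ .robin =
      ∑ l, ((lcuCoeff n a₀ a₁ .robin l : ℝ) : ℂ) • lcuTerm n .robin l := by
  -- Writing the dimension as `2 * N` makes it linear and visibly even, so that `omega` can
  -- determine the parity of the last index.
  obtain ⟨N, hN⟩ : ∃ N, 2 ^ n = 2 * N := ⟨2 ^ (n - 1), by rw [← pow_succ']; congr 1; omega⟩
  change _ = ∑ l : Fin 10, ((![(-4 + (a₀ - a₁) * meshRobin n) / 2, 1 / 2, -1 / 2,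
      (a₀ + a₁) * meshRobin n / 2, 1, 1, -1 / 2, (a₀ - a₁) * meshRobin n / 2,
      (a₀ + a₁) * meshRobin n / 2, 1 / 2] l : ℝ) : ℂ) •
    (![1, onLast n pauliX, xAll n, onLast n pauliZ, incr n, (incr n)ᴴ, cMinus n,
      xAll n * cMinus n, xAll n * cMinus n * onLast n pauliZ,
      xAll n * cMinus n * onLast n pauliX] : Fin 10 → Op n) l
  simp only [Fin.sum_univ_succ, Fin.sum_univ_zero, Matrix.cons_val_zero, Matrix.cons_val_succ]
  ext x y
  have ha := val_lt x
  have hb := val_lt y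
  simp only [laplacian, Matrix.of_apply, Matrix.add_apply, Matrix.smul_apply, smul_eq_mul,
    Matrix.zero_apply, xAll_mul_cMinus, Matrix.diagonal_mul, Matrix.diagonal_apply, ← val_inj,
    one_apply_val, xAll_apply_val, incr_apply_val, conjTranspose_incr_apply_val,
    cMinus_apply_val, onLast_pauliX_apply_val hn, onLast_pauliZ_apply_val hn,
    add_one_mod_eq ha, add_one_mod_eq hb]
  rw [hN] at ha hb ⊢
  generalize val x = a at *
  generalize val y = b at *
  have ha' : a = 0 ∨ a + 1 = 2 * N ∨ (a ≠ 0 ∧ a + 1 ≠ 2 * N) := by omega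
  have hb' : b = 0 ∨ b + 1 = 2 * N ∨ (b ≠ 0 ∧ b + 1 ≠ 2 * N) := by omega
  have hab : a = b ∨ a + 1 = b ∨ b + 1 = a ∨ (a ≠ b ∧ a + 1 ≠ b ∧ b + 1 ≠ a) := by omega
  have hab' : a + b + 1 = 2 * N ∨ a + b + 1 ≠ 2 * N := by omega
  have hp : a % 2 = 0 ∨ a % 2 ≠ 0 := by omega
  rcases ha' with ha' | ha' | ha' <;> rcases hb' with hb' | hb' | hb' <;>
    rcases hab with hab | hab | hab | hab <;> rcases hab' with hab' | hab' <;>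
    rcases hp with hp | hp <;>
    first
      | (exfalso; omega)
      | (simp (disch := omega) only [if_pos, if_neg]; push_cast; ring)

/-! ### The circuits of the Hadamard tests -/

/-- Bounds for the numbers of gates: at most `h` Hadamard gates, at most `B` gates of each
classical kind, at most `v` uses of `V` and at most `p` uses of `U` or its inverse. -/
def CostLe (l : List (Gate n)) (h B v p : ℕ) : Prop :=
  (cost l).had ≤ h ∧ (cost l).x ≤ B ∧ (cost l).cnot ≤ B ∧ (cost l).toffoli ≤ B ∧
    (cost l).ansatz ≤ v ∧ (cost l).prep ≤ p

theorem CostLe.append {l m : List (Gate n)} {h B v p h' B' v' p' : ℕ}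
    (hl : CostLe l h B v p) (hm : CostLe m h' B' v' p') :
    CostLe (l ++ m) (h + h') (B + B') (v + v') (p + p') := by
  have key : cost (l ++ m) = ⟨(cost l).had + (cost m).had, (cost l).x + (cost m).x,
      (cost l).cnot + (cost m).cnot, (cost l).toffoli + (cost m).toffoli,
      (cost l).ansatz + (cost m).ansatz, (cost l).prep + (cost m).prep⟩ := by
    clear hl hm
    induction l with
    | nil => simp [cost]
    | cons g l ih => cases g <;> simp [cost, ih] <;> omega
  unfold CostLe at *
  rw [key]
  dsimp only
  omega

theorem ClassicalWithin.costLe {l : List (Gate n)} {B : ℕ} (h : ClassicalWithin l B) :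
    CostLe l 0 B 0 0 := by
  induction l generalizing B with
  | nil => simp [CostLe, cost]
  | cons g l ih =>
    obtain ⟨h₁, h₂⟩ := h
    simp only [List.mem_cons, forall_eq_or_imp, List.length_cons] at h₁ h₂
    have := ih (B := B - 1) ⟨h₁.2, by omega⟩
    unfold CostLe at *
    cases g <;> first
      | exact h₁.1.elim
      | (simp only [cost]; omega)

theorem ctrlData_onQubit_pauliZ (j : Fin n) :
    ctrlData (onQubit j pauliZ) =
      onQubit 0 hadamard * mapOp (run (cn (dataQubit j) 0)) * onQubit 0 hadamard := by
  have h := ctrlData_mul_hadamard isControlled_nil (isOracle_cn j)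
  rw [← onQubit_pauliZ_eq_signedPerm, show mapOp (run ([] : List (Gate n))) = 1 from mapOp_id,
    one_mul] at h
  rw [← h, mul_assoc, onQubit_hadamard_mul_self, mul_one]

/-- The circuits come from identities of operators valid for arbitrary matrices `V` and `U`, so the
lists of gates cannot depend on them. -/
theorem exists_circuits {R R' : Op n} {B : ℕ} (hR : Implementable R B)
    (hR' : Implementable R' B) :
    (∃ circ : List (Gate n), CostLe circ 2 (4 * B) 1 0 ∧
      ∀ V U : Op n, circuitOp V U circ = betaTest R R' V) ∧
    ∀ j : Fin n, ∃ circ : List (Gate n), CostLe circ 4 (4 * B + 1) 1 2 ∧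
      ∀ V U : Op n, circuitOp V U circ = deltaTest R R' j V U := by
  obtain ⟨π, f, P, M, rfl, cP, cM, hP, hM⟩ := hR
  obtain ⟨π', f', P', M', rfl, cP', cM', hP', hM'⟩ := hR'
  have h := ctrlData_mul_hadamard hP hM
  -- The adjoint of the kickback identity: the sign of `R'†` is absorbed by the last Hadamard gate,
  -- and its oracle runs after that gate.
  have h' : onQubit 0 hadamard * ctrlData (signedPerm π' f')ᴴ =
      mapOp (run M'.reverse) * onQubit 0 hadamard * mapOp (run P'.reverse) := by
    have := congrArg Matrix.conjTranspose (ctrlData_mul_hadamard hP' hM')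
    simpa only [Matrix.conjTranspose_mul, conjTranspose_onQubit, conjTranspose_hadamard,
      ctrlData_eq_blockOp, conjTranspose_blockOp, Matrix.conjTranspose_one,
      conjTranspose_mapOp_run, mul_assoc] using this
  have cH : CostLe ([.had 0] : List (Gate n)) 1 0 0 0 := by simp [CostLe, cost]
  have cV : CostLe ([.ansatz] : List (Gate n)) 0 0 1 0 := by simp [CostLe, cost]
  have cU : CostLe ([.prep] : List (Gate n)) 0 0 0 1 := by simp [CostLe, cost]
  have cU' : CostLe ([.prepInv] : List (Gate n)) 0 0 0 1 := by simp [CostLe, cost]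
  have oH : ∀ V U : Op n, circuitOp V U [.had 0] = onQubit 0 hadamard := fun V U => one_mul _
  have oV : ∀ V U : Op n, circuitOp V U [.ansatz] = onData V := fun V U => one_mul _
  have oU : ∀ V U : Op n, circuitOp V U [.prep] = onData U := fun V U => one_mul _
  have oU' : ∀ V U : Op n, circuitOp V U [.prepInv] = onData Uᴴ := fun V U => one_mul _
  have start : ∀ (V : Op n) (A : Op (n + 2)),
      A * ctrlData (signedPerm π f) * onData V * onQubit 0 hadamard =
        A * (mapOp (run P) * onQubit 0 hadamard * mapOp (run M) * onData V) := fun V A => by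
    rw [mul_assoc, onData_mul_onQubit_zero, ← mul_assoc, mul_assoc A, h, mul_assoc A]
  have c₁ := ((cV.append cM.costLe).append cH).append cP.costLe
  have c₂ := (cP'.reverse.costLe.append cH).append cM'.reverse.costLe
  constructor
  · refine ⟨([.ansatz] ++ M ++ [.had 0] ++ P) ++ (P'.reverse ++ [.had 0] ++ M'.reverse), ?_,
      fun V U => ?_⟩
    · convert c₁.append c₂ using 1; ring
    · simp only [circuitOp_append, oH, oV, circuitOp_eq_mapOp cM.1, circuitOp_eq_mapOp cP.1,
        circuitOp_eq_mapOp cP'.reverse.1, circuitOp_eq_mapOp cM'.reverse.1, betaTest]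
      rw [h', start]
      simp only [mul_assoc]
  · intro j
    have cj := classicalWithin_cn (n := n) (dataQubit j) 0
    refine ⟨(([.ansatz] ++ M ++ [.had 0] ++ P) ++ ([.prepInv] ++ [.had 0] ++ cn (dataQubit j) 0 ++
      [.had 0] ++ [.prep])) ++ (P'.reverse ++ [.had 0] ++ M'.reverse), ?_, fun V U => ?_⟩
    · convert (c₁.append ((((cU'.append cH).append cj.costLe).append cH).append cU)).append c₂
        using 1
      ring
    · simp only [circuitOp_append, oH, oV, oU, oU', circuitOp_eq_mapOp cM.1,
        circuitOp_eq_mapOp cP.1, circuitOp_eq_mapOp cP'.reverse.1,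
        circuitOp_eq_mapOp cM'.reverse.1, circuitOp_eq_mapOp cj.1, deltaTest]
      rw [h', ctrlData_onQubit_pauliZ, start]
      simp only [mul_assoc]

/-! ### What the Hadamard tests measure -/

theorem estimates_betaTest (R R' V : Op n) : Estimates (betaTest R R' V) (beta R R' V) := by
  have h := estimates_hadamardTest V (R'ᴴ * R * V)
  have e : betaTest R R' V =
      onQubit 0 hadamard * blockOp V (R'ᴴ * R * V) * onQubit 0 hadamard := by
    rw [betaTest, ctrlData_eq_blockOp, ctrlData_eq_blockOp, onData_eq_blockOp,
      mul_assoc (onQubit 0 hadamard), blockOp_mul_blockOp, mul_assoc (onQubit 0 hadamard),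
      blockOp_mul_blockOp, one_mul, one_mul]
  rw [e, beta]
  simpa only [mul_assoc] using h

/-- `U` and its inverse are applied without control; in the branch where the test qubit is `0` they
cancel and leave `V`, as in the test for `beta`. -/
theorem estimates_deltaTest (R R' : Op n) (j : Fin n) (V : Op n) {U : Op n} (hU : U * Uᴴ = 1) :
    Estimates (deltaTest R R' j V U) (delta R R' j V U) := by
  have h := estimates_hadamardTest V (R'ᴴ * U * onQubit j pauliZ * Uᴴ * R * V)
  have e : deltaTest R R' j V U = onQubit 0 hadamard *
      blockOp V (R'ᴴ * U * onQubit j pauliZ * Uᴴ * R * V) * onQubit 0 hadamard := by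
    simp only [deltaTest, ctrlData_eq_blockOp, onData_eq_blockOp, mul_assoc (onQubit 0 hadamard),
      blockOp_mul_blockOp, one_mul, mul_one, hU]
  rw [e, delta]
  simpa only [mul_assoc] using h

theorem Implementable.isReal {R : Op n} {B : ℕ} (h : Implementable R B) : IsReal R := by
  obtain ⟨π, f, P, M, rfl, -⟩ := h
  exact isReal_signedPerm π f

theorem Implementable.mem_unitaryGroup {R : Op n} {B : ℕ} (h : Implementable R B) :
    R ∈ Matrix.unitaryGroup (Basis n) ℂ := by
  obtain ⟨π, f, P, M, rfl, -⟩ := h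
  exact signedPerm_mem_unitaryGroup π f

end VQLS

/-! ### Assembly -/

theorem mainTheorem6 :
    (∀ (n : ℕ), 1 ≤ n → ∀ (a₀ a₁ : ℝ) (α : VQLS.Boundary),
      VQLS.laplacian n a₀ a₁ α
          = ∑ l, ((VQLS.lcuCoeff n a₀ a₁ α l : ℝ) : ℂ) • VQLS.lcuTerm n α l ∧
        ∀ l, VQLS.lcuTerm n α l ∈ Matrix.unitaryGroup (VQLS.Basis n) ℂ) ∧
    ∃ K : ℕ, ∀ (n : ℕ), 1 ≤ n → ∀ (α : VQLS.Boundary) (l l' : Fin (VQLS.numTerms α)),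
      (∃ circ : List (VQLS.Gate n), (VQLS.cost circ).Within (K * n) ∧
        ∀ V ∈ Matrix.unitaryGroup (VQLS.Basis n) ℂ, ∀ U ∈ Matrix.unitaryGroup (VQLS.Basis n) ℂ,
          VQLS.circuitOp V U circ
              = VQLS.betaTest (VQLS.lcuTerm n α l) (VQLS.lcuTerm n α l') V ∧
            VQLS.Estimates (VQLS.circuitOp V U circ)
              (VQLS.beta (VQLS.lcuTerm n α l) (VQLS.lcuTerm n α l') V) ∧
            (VQLS.IsReal V →
              (VQLS.beta (VQLS.lcuTerm n α l) (VQLS.lcuTerm n α l') V).im = 0)) ∧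
      ∀ j : Fin n, ∃ circ : List (VQLS.Gate n), (VQLS.cost circ).Within (K * n) ∧
        ∀ V ∈ Matrix.unitaryGroup (VQLS.Basis n) ℂ, ∀ U ∈ Matrix.unitaryGroup (VQLS.Basis n) ℂ,
          VQLS.circuitOp V U circ
              = VQLS.deltaTest (VQLS.lcuTerm n α l) (VQLS.lcuTerm n α l') j V U ∧
            VQLS.Estimates (VQLS.circuitOp V U circ)
              (VQLS.delta (VQLS.lcuTerm n α l) (VQLS.lcuTerm n α l') j V U) ∧
            (VQLS.IsReal V → VQLS.IsReal U →
              (VQLS.delta (VQLS.lcuTerm n α l) (VQLS.lcuTerm n α l') j V U).im = 0) := by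
  -- Four classical blocks of at most `40 n` gates and one CNOT for controlled `Z_j` give `160 n + 1
  -- ≤ 161 n`.
  refine ⟨fun n hn a₀ a₁ α => ⟨?_, fun l => (VQLS.implementable_lcuTerm hn α l).mem_unitaryGroup⟩,
    161, fun n hn α l l' => ?_⟩
  · cases α
    exacts [VQLS.laplacian_dirichlet hn a₀ a₁, VQLS.laplacian_periodic a₀ a₁,
      VQLS.laplacian_robin hn a₀ a₁]
  · have hR := VQLS.implementable_lcuTerm hn α l
    have hR' := VQLS.implementable_lcuTerm hn α l'
    obtain ⟨⟨circ, hc, he⟩, hd⟩ := VQLS.exists_circuits hR hR'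
    refine ⟨⟨circ, ?_, fun V _ U _ => ⟨he V U, ?_, fun hV => ?_⟩⟩, fun j => ?_⟩
    · unfold VQLS.CostLe at hc
      unfold VQLS.Cost.Within
      omega
    · rw [he]
      exact VQLS.estimates_betaTest _ _ _
    · exact ((hV.conjTranspose.mul hR'.isReal.conjTranspose).mul hR.isReal).mul hV 0 0
    · obtain ⟨circ, hc, he⟩ := hd j
      refine ⟨circ, ?_, fun V _ U hU => ⟨he V U, ?_, fun hV hU' => ?_⟩⟩
      · unfold VQLS.CostLe at hc
        unfold VQLS.Cost.Within
        omega
      · rw [he]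
        exact VQLS.estimates_deltaTest _ _ _ _ (Matrix.mem_unitaryGroup_iff.1 hU)
      · have hZ : VQLS.IsReal (VQLS.onQubit j VQLS.pauliZ) := by
          rw [VQLS.onQubit_pauliZ_eq_signedPerm]
          exact VQLS.isReal_signedPerm _ _
        exact (((((hV.conjTranspose.mul hR'.isReal.conjTranspose).mul hU').mul hZ).mul
          hU'.conjTranspose).mul hR.isReal).mul hV 0 0
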